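/- Let $d\ge 2$ be an integer, and let $\sigma$ be the normalized surface measure on the unit sphere $\mathbb S^{d-1}\subset\mathbb R^d$. For a function $f$ on $\mathbb R^d$ set $$A_tf(x)=\int_{\mathbb S^{d-1}}f(x-ty)\,d\sigma(y),\qquad M_{[1,2]}f(x)=\sup_{1\le t\le 2}|A_tf(x)| .$$ Let $L^p_{\mathrm{rad}}$ be the space of radial functions in $L^p(\mathbb R^d)$ (represented by functions that depend only on $|x|$), and let the radial type set $\mathcal T^{rad}_{[1,2]}$ be the set of all $(\tfrac1p,\tfrac1q)\in[0,1]^2$, with $1\le p,q\le\infty$ and $\tfrac1\infty=0$, such that $M_{[1,2]}$ is bounded from $L^p_{\mathrm{rad}}$ to $L^q(\mathbb R^d)$; that is, there is a finite constant $C$ such that for every $f\in L^p_{\mathrm{rad}}$ the function $M_{[1,2]}f$ is measurable and $\|M_{[1,2]}f\|_{L^q}\le C\|f\|_{L^p}$. Let $\Delta(1)$ be the closed triangle with vertices $$O=(0,0),\qquad Q_1(1)=\Big(\frac{d-1}{d},\frac{d-1}{d}\Big),\qquad Q_2(1)=\Big(\frac{d-1}{d},\frac{d-1}{d^2}\Big),$$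 and let $[Q_1(1),Q_2(1)]$ be the closed segment joining $Q_1(1)$ and $Q_2(1)$. Then $$\mathcal T^{rad}_{[1,2]}=\Delta(1)\setminus[Q_1(1),Q_2(1)].$$ Moreover, whenever $M_{[1,2]}$ is bounded from $L^p_{\mathrm{rad}}$ to $L^q$, for every $f\in L^p_{\mathrm{rad}}$ and almost every $x$ the integrals defining $A_tf(x)$ converge absolutely for all $t\in[1,2]$. -/

import Mathlib

open MeasureTheory
open scoped NNReal ENNReal

noncomputable section

/-- The normalized surface measure on the unit sphere of `ℝ^d`. -/
def sphereMeasure (d : ℕ) : Measure (Metric.sphere (0 : EuclideanSpace ℝ (Fin d)) 1) :=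
  ((volume : Measure (EuclideanSpace ℝ (Fin d))).toSphere Set.univ)⁻¹ •
    (volume : Measure (EuclideanSpace ℝ (Fin d))).toSphere

/-- The restriction of `f` to the sphere of centre `x` and radius `t`, parametrized by
the unit sphere. -/
def onSphere {d : ℕ} (f : EuclideanSpace ℝ (Fin d) → ℂ) (t : ℝ) (x : EuclideanSpace ℝ (Fin d)) :
    Metric.sphere (0 : EuclideanSpace ℝ (Fin d)) 1 → ℂ :=
  fun y => f (x - t • (y : EuclideanSpace ℝ (Fin d)))

/-- The spherical mean `A_t f(x) = ∫ f(x - t y) dσ(y)`. -/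
def sphericalMean {d : ℕ} (f : EuclideanSpace ℝ (Fin d) → ℂ) (t : ℝ)
    (x : EuclideanSpace ℝ (Fin d)) : ℂ :=
  ∫ y, onSphere f t x y ∂(sphereMeasure d)

/-- The spherical maximal function `M_E f(x) = sup_{t ∈ E} |A_t f(x)|`, with values in `[0, ∞]`. -/
def sphericalMaximal {d : ℕ} (E : Set ℝ) (f : EuclideanSpace ℝ (Fin d) → ℂ)
    (x : EuclideanSpace ℝ (Fin d)) : ℝ≥0∞ :=
  ⨆ t ∈ E, ‖sphericalMean f t x‖ₑ

/-- A function on `ℝ^d` is radial if its value at `x` depends only on `|x|`. -/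
def IsRadial {d : ℕ} (f : EuclideanSpace ℝ (Fin d) → ℂ) : Prop :=
  ∀ x y, ‖x‖ = ‖y‖ → f x = f y

/-- `M_E` is bounded from `L^p_rad(ℝ^d)` to `L^q(ℝ^d)`: for every radial `f` in `L^p`, the
function `M_E f` is measurable and `‖M_E f‖_q ≤ C ‖f‖_p`, with `C` independent of `f`. -/
def IsRadialStrongType (d : ℕ) (E : Set ℝ) (p q : ℝ≥0∞) : Prop :=
  ∃ C : ℝ≥0, ∀ f : EuclideanSpace ℝ (Fin d) → ℂ, IsRadial f → MemLp f p volume →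
    AEMeasurable (sphericalMaximal E f) volume ∧
      eLpNorm (sphericalMaximal E f) q volume ≤ C * eLpNorm f p volume

/-- The radial type set: all `(1/p, 1/q) ∈ [0,1]²` (so `1 ≤ p, q ≤ ∞`, with `1/∞ = 0`) such that
`M_E` is bounded from `L^p_rad(ℝ^d)` to `L^q(ℝ^d)`. -/
def radialTypeSet (d : ℕ) (E : Set ℝ) : Set (ℝ × ℝ) :=
  {z | ∃ p q : ℝ≥0∞, 1 ≤ p ∧ 1 ≤ q ∧ z = ((p⁻¹).toReal, (q⁻¹).toReal) ∧
    IsRadialStrongType d E p q}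

/-- The vertex `Q₁(β)`. -/
def vertexQ1 (d : ℕ) (β : ℝ) : ℝ × ℝ :=
  (((d : ℝ) - 1) / ((d : ℝ) - 1 + β), ((d : ℝ) - 1) / ((d : ℝ) - 1 + β))

/-- The vertex `Q₂(β)`. -/
def vertexQ2 (d : ℕ) (β : ℝ) : ℝ × ℝ :=
  ((d : ℝ) * ((d : ℝ) - 1) / ((d : ℝ) ^ 2 - 1 + β), ((d : ℝ) - 1) / ((d : ℝ) ^ 2 - 1 + β))

/-- The closed triangle `Δ(β)` with vertices `O`, `Q₁(β)`, `Q₂(β)`. -/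
def triangleDelta (d : ℕ) (β : ℝ) : Set (ℝ × ℝ) :=
  convexHull ℝ {((0 : ℝ), (0 : ℝ)), vertexQ1 d β, vertexQ2 d β}

end

/-! For radial `f`, with profile `h` for its modulus, the mean over the sphere of centre `x` and
radius `t` is a one-dimensional integral in the angle `θ` between the point on the sphere and `x`,
with density `sin θ ^ (d - 2)`. The distance of that point from the origin is `s = chord ‖x‖ t θ`,
and `s ds = ‖x‖ t sin θ dθ`.

Sufficiency. Hölder's inequality with a suitable split of the density bounds every mean by an `L^p`
norm of `h` over an annulus, exactly when `p > d / (d - 1)` (`lintegral_sphere_le_annulus`).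
Uniformly in `t ∈ [1, 2]` this gives `(M f)^p ≲ ‖x‖⁻¹ ‖f‖_p^p` for all `x ≠ 0`, and for `‖x‖ ≥ 4`
the bound `‖x‖^{-(d-1)}` times the integral of `|f|^p` over an annulus of bounded width. The first
bound confines the near part of a level set to a small ball, and the second gives a weak `(p, p)`
bound for the far part. Together they yield weak type `(p, kp)` for every `1 ≤ k ≤ d`
(`radialMaximal_weak`). On each ray `q = kp` the range of `p` is open, so interpolation with the
trivial `L^∞` bound upgrades weak to strong type (`lintegral_rpow_le_of_weak`). The rays `1 ≤ k ≤ d`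
with `1/p < (d-1)/d` fill the triangle without its far side.

Necessity. Large balls force `1/q ≤ 1/p`. Thin annuli around the unit sphere, whose means are one
near the origin, force `1/p ≤ d/q`. The profile `s^{-(d-1)}` cut off at `a` has critical norm of
order `(log 1/a)^{(d-1)/d}`, but its means over spheres through the origin are of order `log 1/a`,
which excludes `1/p ≥ (d-1)/d`.

Since the supremum runs over uncountably many radii, measurability needs an argument: the maximal
function is a pointwise limit, off the origin, of maximal functions of continuous radial functions.
The pointwise near bound also gives the absolute convergence of all the integrals at every `x ≠ 0`.
-/

/-! ### Polar coordinates and integration of zonal functions on the sphere. -/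

/-- Polar coordinates for the lower Lebesgue integral. -/
theorem lintegral_eq_lintegral_sphere_lintegral {E : Type*} [NormedAddCommGroup E]
    [NormedSpace ℝ E] [MeasurableSpace E] [BorelSpace E] [FiniteDimensional ℝ E] [Nontrivial E]
    (μ : Measure E) [μ.IsAddHaarMeasure] {F : E → ℝ≥0∞} (hF : Measurable F) :
    ∫⁻ x, F x ∂μ = ∫⁻ y : Metric.sphere (0 : E) 1, (∫⁻ r in Set.Ioi (0 : ℝ),
      ENNReal.ofReal (r ^ (Module.finrank ℝ E - 1)) * F (r • (y : E))) ∂μ.toSphere := by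
  have h1 := μ.measurePreserving_homeomorphUnitSphereProd.lintegral_comp_emb
    (Homeomorph.measurableEmbedding _)
    (fun z : Metric.sphere (0 : E) 1 × Set.Ioi (0 : ℝ) => F ((z.2 : ℝ) • (z.1 : E)))
  have h2 : ∀ x : ({0}ᶜ : Set E), F (((homeomorphUnitSphereProd E x).2 : ℝ) •
      ((homeomorphUnitSphereProd E x).1 : E)) = F x := by
    intro x
    have hx : ‖(x : E)‖ ≠ 0 := norm_ne_zero_iff.2 x.2
    simp [smul_smul, hx]
  simp only [h2] at h1
  rw [lintegral_subtype_comap (measurableSet_singleton (0 : E)).compl (fun x => F x),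
    restrict_compl_singleton] at h1
  have hm : Measurable (fun z : Metric.sphere (0 : E) 1 × Set.Ioi (0 : ℝ) =>
      F ((z.2 : ℝ) • (z.1 : E))) := by
    apply hF.comp
    fun_prop
  rw [h1, lintegral_prod _ hm.aemeasurable]
  refine lintegral_congr fun y => ?_
  rw [Measure.volumeIoiPow, lintegral_withDensity_eq_lintegral_mul _ (by fun_prop)
    (by exact hF.comp (by fun_prop))]
  exact lintegral_subtype_comap measurableSet_Ioi
    (fun r : ℝ => ENNReal.ofReal (r ^ (Module.finrank ℝ E - 1)) * F (r • (y : E)))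

/-- Integration of radial functions. -/
theorem lintegral_comp_norm {E : Type*} [NormedAddCommGroup E]
    [NormedSpace ℝ E] [MeasurableSpace E] [BorelSpace E] [FiniteDimensional ℝ E] [Nontrivial E]
    (μ : Measure E) [μ.IsAddHaarMeasure] {h : ℝ → ℝ≥0∞} (hh : Measurable h) :
    ∫⁻ x, h ‖x‖ ∂μ = μ.toSphere Set.univ * ∫⁻ r in Set.Ioi (0 : ℝ),
      ENNReal.ofReal (r ^ (Module.finrank ℝ E - 1)) * h r := by
  rw [lintegral_eq_lintegral_sphere_lintegral μ (F := fun x => h ‖x‖) (hh.comp measurable_norm),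
    mul_comm,
    ← lintegral_const]
  refine lintegral_congr fun y => setLIntegral_congr_fun measurableSet_Ioi fun r hr => ?_
  have : ‖(y : E)‖ = 1 := by simp
  simp [norm_smul, this, abs_of_pos hr.out]

/-- Integration of functions of `(⟪e, x⟫, ‖x‖)` along the orthogonal decomposition given by
a unit vector `e`. -/
theorem lintegral_inner_norm {E : Type*} [NormedAddCommGroup E]
    [InnerProductSpace ℝ E] [MeasurableSpace E] [BorelSpace E] [FiniteDimensional ℝ E]
    {e : E} (he : ‖e‖ = 1) {G : ℝ → ℝ → ℝ≥0∞} (hG : Measurable (Function.uncurry G)) :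
    ∫⁻ x : E, G (inner ℝ e x) ‖x‖ = ∫⁻ a : ℝ, ∫⁻ w : (Submodule.span ℝ {e})ᗮ,
      G a (Real.sqrt (a ^ 2 + ‖w‖ ^ 2)) := by
  set K := Submodule.span ℝ {e}
  let φ : ℝ ≃ₗᵢ[ℝ] K := LinearIsometryEquiv.toSpanUnitSingleton e he
  have hmp : MeasurePreserving (fun z : K × Kᗮ => K.orthogonalDecomposition.symm
      (WithLp.toLp 2 z)) (volume.prod volume) volume :=
    (K.orthogonalDecomposition.symm.measurePreserving).comp (WithLp.volume_preserving_toLp K Kᗮ)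
  have hval : ∀ z : K × Kᗮ, K.orthogonalDecomposition.symm (WithLp.toLp 2 z) =
      (z.1 : E) + (z.2 : E) := by
    intro z
    simp [Submodule.orthogonalDecomposition_symm_apply]
  have hm : Measurable (fun x : E => G (inner ℝ e x) ‖x‖) :=
    hG.comp (by fun_prop : Measurable fun x : E => ((inner ℝ e x : ℝ), ‖x‖))
  refine (hmp.lintegral_comp hm).symm.trans ?_
  refine (lintegral_prod _ (hm.comp hmp.measurable).aemeasurable).trans ?_
  rw [← φ.measurePreserving.lintegral_comp_emb φ.toHomeomorph.measurableEmbedding]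
  refine lintegral_congr fun a => lintegral_congr fun w => ?_
  change G (inner ℝ e (K.orthogonalDecomposition.symm (WithLp.toLp 2 (φ a, w))))
    ‖K.orthogonalDecomposition.symm (WithLp.toLp 2 (φ a, w))‖ = _
  rw [hval]
  have hφ : ((φ a : K) : E) = a • e := rfl
  have hw : inner ℝ e (w : E) = 0 :=
    (Submodule.mem_orthogonal K _).1 w.2 e (Submodule.mem_span_singleton_self e)
  simp only [hφ]
  congr 1
  · simp [inner_add_right, inner_smul_right, hw, he]
  · symm
    rw [Real.sqrt_eq_iff_mul_self_eq (by positivity) (norm_nonneg _), ← sq,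
      norm_add_sq_real, inner_smul_left, hw, norm_smul, he]
    simp

/-- The integral of `g (⟪e, x⟫ / ‖x‖) * w ‖x‖` over `E` is computed in two ways. Polar coordinates
give the sphere integral times a radial factor `W`. Splitting off the line through `e` and using
polar coordinates first in its orthogonal complement, then in the half-plane `b > 0`, gives the
angular integral times the same `W`, which cancels. -/
theorem lintegral_sphere_inner_mul {E : Type*} [NormedAddCommGroup E] [InnerProductSpace ℝ E]
    [MeasurableSpace E] [BorelSpace E] [FiniteDimensional ℝ E] {d : ℕ}
    (hdim : Module.finrank ℝ E = d) (hd : 2 ≤ d) {e : E} (he : ‖e‖ = 1) : ∃ c : ℝ≥0∞, c ≠ 0 ∧ c ≠ ∞ ∧ ∀ g : ℝ → ℝ≥0∞, Measurable g →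
      ∫⁻ y : Metric.sphere (0 : E) 1, g (inner ℝ e (y : E))
        ∂(volume : Measure (E)).toSphere =
      c * ∫⁻ θ in Set.Ioo 0 Real.pi, ENNReal.ofReal (Real.sin θ ^ (d - 2)) * g (Real.cos θ) := by
  set K := Submodule.span ℝ {e}
  have hKdim : Module.finrank ℝ Kᗮ = d - 1 := by
    have h1 := K.finrank_add_finrank_orthogonal
    rw [finrank_span_singleton (norm_ne_zero_iff.1 (by rw [he]; norm_num)), hdim] at h1
    omega
  have : Nontrivial Kᗮ := Module.nontrivial_of_finrank_pos (R := ℝ) (by omega)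
  have : Nontrivial E := Module.nontrivial_of_finrank_pos (R := ℝ) (by omega)
  -- The cutoff only serves to make `W` finite and nonzero, as the volume of the unit ball shows.
  set w : ℝ → ℝ≥0∞ := (Set.Iio (1 : ℝ)).indicator 1
  have hw : Measurable w := measurable_one.indicator measurableSet_Iio
  set W := ∫⁻ r in Set.Ioi (0 : ℝ), ENNReal.ofReal (r ^ (d - 1)) * w r
  have hball : ∫⁻ x : E, w ‖x‖ = volume (Metric.ball (0 : E) 1) := by
    rw [← lintegral_indicator_one Metric.isOpen_ball.measurableSet]
    refine lintegral_congr fun x => ?_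
    by_cases hx : ‖x‖ < 1
    · rw [Set.indicator_of_mem (mem_ball_zero_iff.2 hx)]
      exact Set.indicator_of_mem (s := Set.Iio (1 : ℝ)) hx _
    · rw [Set.indicator_of_notMem (fun h => hx (mem_ball_zero_iff.1 h))]
      exact Set.indicator_of_notMem (s := Set.Iio (1 : ℝ)) hx _
  rw [lintegral_comp_norm volume hw, hdim] at hball
  have hW0 : W ≠ 0 := by
    intro h
    rw [show ∫⁻ r in Set.Ioi (0 : ℝ), ENNReal.ofReal (r ^ (d - 1)) * w r = 0 from h] at hball
    exact (Metric.measure_ball_pos volume (0 : E) one_pos).ne' (by simpa using hball.symm)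
  have hWt : W ≠ ∞ := by
    intro h
    rw [show ∫⁻ r in Set.Ioi (0 : ℝ), ENNReal.ofReal (r ^ (d - 1)) * w r = ∞ from h,
      ENNReal.mul_top (by exact Measure.measure_univ_ne_zero.2 (Measure.toSphere_ne_zero _))] at hball
    exact measure_ball_lt_top.ne hball.symm
  refine ⟨(volume : Measure Kᗮ).toSphere Set.univ, Measure.measure_univ_ne_zero.2 (Measure.toSphere_ne_zero _),
    measure_ne_top _ _, fun g hg => ?_⟩
  set c := (volume : Measure Kᗮ).toSphere Set.univ
  set J := ∫⁻ θ in Set.Ioo 0 Real.pi, ENNReal.ofReal (Real.sin θ ^ (d - 2)) * g (Real.cos θ)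
  have hG : Measurable (Function.uncurry fun a r : ℝ => g (a / r) * w r) := by
    exact (hg.comp (measurable_fst.div measurable_snd)).mul (hw.comp measurable_snd)
  have key : ∫⁻ x : E, g (inner ℝ e x / ‖x‖) * w ‖x‖ = ∫⁻ a : ℝ, ∫⁻ z : Kᗮ,
      g (a / Real.sqrt (a ^ 2 + ‖z‖ ^ 2)) * w (Real.sqrt (a ^ 2 + ‖z‖ ^ 2)) :=
    lintegral_inner_norm he hG
  rw [lintegral_eq_lintegral_sphere_lintegral volume
    (F := fun x : E => g (inner ℝ e x / ‖x‖) * w ‖x‖)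
    (hG.comp (by fun_prop : Measurable fun x : E => ((inner ℝ e x : ℝ), ‖x‖))), hdim] at key
  have hL : ∀ y : Metric.sphere (0 : E) 1, ∫⁻ r in Set.Ioi (0 : ℝ), ENNReal.ofReal (r ^ (d - 1)) *
      (g (inner ℝ e (r • (y : E)) / ‖r • (y : E)‖) * w ‖r • (y : E)‖) =
      W * g (inner ℝ e (y : E)) := by
    intro y
    rw [← lintegral_mul_const _ (by fun_prop)]
    refine setLIntegral_congr_fun measurableSet_Ioi fun r hr => ?_
    have hy : ‖(y : E)‖ = 1 := by simp
    have hr' : r ≠ 0 := hr.out.ne'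
    simp only [norm_smul, hy, Real.norm_eq_abs, abs_of_pos hr.out, inner_smul_right, mul_one]
    rw [mul_div_cancel_left₀ _ hr']
    ring
  simp only [hL] at key
  rw [lintegral_const_mul _ (by fun_prop)] at key
  have hR : ∀ a : ℝ, ∫⁻ z : Kᗮ, g (a / Real.sqrt (a ^ 2 + ‖z‖ ^ 2)) *
      w (Real.sqrt (a ^ 2 + ‖z‖ ^ 2)) = c * ∫⁻ b in Set.Ioi (0 : ℝ), ENNReal.ofReal (b ^ (d - 2)) *
        (g (a / Real.sqrt (a ^ 2 + b ^ 2)) * w (Real.sqrt (a ^ 2 + b ^ 2))) := by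
    intro a
    rw [lintegral_comp_norm volume (h := fun b => g (a / Real.sqrt (a ^ 2 + b ^ 2)) *
      w (Real.sqrt (a ^ 2 + b ^ 2))) (by fun_prop), hKdim]
    rfl
  simp only [hR] at key
  set F : ℝ × ℝ → ℝ≥0∞ := fun p => (Set.Ioi (0 : ℝ)).indicator 1 p.2 *
    (ENNReal.ofReal (p.2 ^ (d - 2)) *
        (g (p.1 / Real.sqrt (p.1 ^ 2 + p.2 ^ 2)) * w (Real.sqrt (p.1 ^ 2 + p.2 ^ 2))))
  have hind : Measurable ((Set.Ioi (0 : ℝ)).indicator (1 : ℝ → ℝ≥0∞)) :=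
    measurable_one.indicator measurableSet_Ioi
  have hF : Measurable F := by fun_prop
  have hFint : ∀ a : ℝ, ∫⁻ b in Set.Ioi (0 : ℝ), ENNReal.ofReal (b ^ (d - 2)) *
        (g (a / Real.sqrt (a ^ 2 + b ^ 2)) * w (Real.sqrt (a ^ 2 + b ^ 2))) = ∫⁻ b, F (a, b) := by
    intro a
    rw [← lintegral_indicator measurableSet_Ioi]
    refine lintegral_congr fun b => ?_
    by_cases hb : b ∈ Set.Ioi (0 : ℝ) <;> simp [F, hb]
  simp only [hFint] at key
  have hFa : Measurable fun a => ∫⁻ b, F (a, b) := hF.lintegral_prod_right'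
  rw [lintegral_const_mul _ hFa, ← lintegral_prod _ hF.aemeasurable,
    ← Measure.volume_eq_prod, ← lintegral_comp_polarCoord_symm, polarCoord_target,
    Measure.volume_eq_prod, ← Measure.prod_restrict] at key
  -- The planar Jacobian `r` turns `(r sin θ)^(d-2)` into `r^(d-1) sin θ^(d-2)`, so the radial
  -- factor is again that of `W`; the condition `b > 0` becomes `θ ∈ (0, π)`.
  have hFp : ∀ p ∈ Set.Ioi (0 : ℝ) ×ˢ Set.Ioo (-Real.pi) Real.pi,
      ENNReal.ofReal p.1 • F (polarCoord.symm p) = (ENNReal.ofReal (p.1 ^ (d - 1)) * w p.1) *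
        (Set.Ioo 0 Real.pi).indicator
          (fun θ => ENNReal.ofReal (Real.sin θ ^ (d - 2)) * g (Real.cos θ)) p.2 := by
    rintro ⟨r, θ⟩ ⟨hr, hθ1, hθ2⟩
    simp only [Set.mem_Ioi] at hr hθ1 hθ2
    have hsq : Real.sqrt ((r * Real.cos θ) ^ 2 + (r * Real.sin θ) ^ 2) = r := by
      rw [Real.sqrt_eq_iff_mul_self_eq (by positivity) hr.le]
      nlinarith [Real.sin_sq_add_cos_sq θ]
    simp only [polarCoord_symm_apply, F, hsq, smul_eq_mul]
    by_cases hθ : 0 < θ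
    · have hs : 0 < Real.sin θ := Real.sin_pos_of_pos_of_lt_pi hθ hθ2
      rw [Set.indicator_of_mem (show r * Real.sin θ ∈ Set.Ioi (0 : ℝ) from mul_pos hr hs),
        Set.indicator_of_mem (show θ ∈ Set.Ioo 0 Real.pi from ⟨hθ, hθ2⟩),
        mul_div_cancel_left₀ _ hr.ne', mul_pow, ENNReal.ofReal_mul (by positivity),
        show d - 1 = (d - 2) + 1 by omega, pow_succ, ENNReal.ofReal_mul (by positivity)]
      simp only [Pi.one_apply]
      ring
    · have hs : Real.sin θ ≤ 0 := Real.sin_nonpos_of_nonpos_of_neg_pi_le (not_lt.1 hθ) hθ1.le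
      rw [Set.indicator_of_notMem (s := Set.Ioi (0 : ℝ)), Set.indicator_of_notMem]
      · simp
      · exact fun h => hθ h.1
      · simpa using mul_nonpos_of_nonneg_of_nonpos hr.le hs
  have hmeas : Measurable (fun θ => ENNReal.ofReal (Real.sin θ ^ (d - 2)) * g (Real.cos θ)) := by
    fun_prop
  rw [Measure.prod_restrict, setLIntegral_congr_fun (measurableSet_Ioi.prod measurableSet_Ioo) hFp,
    ← Measure.prod_restrict, lintegral_prod_mul (f := fun r => ENNReal.ofReal (r ^ (d - 1)) * w r) (by fun_prop)
      (hmeas.indicator measurableSet_Ioo).aemeasurable,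
    lintegral_indicator measurableSet_Ioo, Measure.restrict_restrict measurableSet_Ioo,
    Set.inter_eq_left.2 (Set.Ioo_subset_Ioo_left (by linarith [Real.pi_pos]))] at key
  have key' : W * ∫⁻ y : Metric.sphere (0 : E) 1, g (inner ℝ e (y : E))
      ∂(volume : Measure E).toSphere = W * (c * J) := by
    rw [key]; ring
  exact (ENNReal.mul_right_inj hW0 hWt).1 key'

/-- The normalizing constant of the zonal density `sin θ ^ (d - 2)`. -/
noncomputable def zonalConst (d : ℕ) : ℝ≥0∞ :=
  (∫⁻ θ in Set.Ioo 0 Real.pi, ENNReal.ofReal (Real.sin θ ^ (d - 2)))⁻¹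

theorem exists_norm_eq_one_euclidean {d : ℕ} (hd : 2 ≤ d) :
    ∃ e : EuclideanSpace ℝ (Fin d), ‖e‖ = 1 :=
  ⟨EuclideanSpace.single ⟨0, by omega⟩ 1, by simp⟩

theorem nontrivial_euclidean {d : ℕ} (hd : 2 ≤ d) : Nontrivial (EuclideanSpace ℝ (Fin d)) :=
  Module.nontrivial_of_finrank_pos (R := ℝ) (by simp; omega)

theorem toSphere_univ_ne_zero {d : ℕ} (hd : 2 ≤ d) :
    (volume : Measure (EuclideanSpace ℝ (Fin d))).toSphere Set.univ ≠ 0 :=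
  have := nontrivial_euclidean hd
  Measure.measure_univ_ne_zero.2 (Measure.toSphere_ne_zero _)

theorem isProbabilityMeasure_sphereMeasure {d : ℕ} (hd : 2 ≤ d) :
    IsProbabilityMeasure (sphereMeasure d) :=
  ⟨by
    rw [sphereMeasure, Measure.smul_apply, smul_eq_mul]
    exact ENNReal.inv_mul_cancel (toSphere_univ_ne_zero hd) (measure_ne_top _ _)⟩

theorem zonalConst_ne_zero_and_ne_top {d : ℕ} (hd : 2 ≤ d) :
    zonalConst d ≠ 0 ∧ zonalConst d ≠ ∞ := by
  obtain ⟨e, he⟩ := exists_norm_eq_one_euclidean hd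
  obtain ⟨c, hc0, hct, hc⟩ := lintegral_sphere_inner_mul (by simp) hd he
  have h1 := hc 1 measurable_one
  simp only [Pi.one_apply, mul_one, lintegral_one] at h1
  constructor
  · refine ENNReal.inv_ne_zero.2 fun h => ?_
    rw [h, ENNReal.mul_top hc0] at h1
    exact measure_ne_top _ _ h1
  · refine ENNReal.inv_ne_top.2 fun h => ?_
    rw [h, mul_zero] at h1
    exact toSphere_univ_ne_zero hd h1

/-- Slicing the unit sphere by the hyperplanes orthogonal to `e`. -/
theorem lintegral_sphereMeasure_inner {d : ℕ} (hd : 2 ≤ d) {e : EuclideanSpace ℝ (Fin d)}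
    (he : ‖e‖ = 1) {g : ℝ → ℝ≥0∞} (hg : Measurable g) :
    ∫⁻ y, g (inner ℝ e (y : EuclideanSpace ℝ (Fin d))) ∂(sphereMeasure d) =
      zonalConst d *
        ∫⁻ θ in Set.Ioo 0 Real.pi, ENNReal.ofReal (Real.sin θ ^ (d - 2)) * g (Real.cos θ) := by
  obtain ⟨c, hc0, hct, hc⟩ := lintegral_sphere_inner_mul (by simp) hd he
  have h1 := hc 1 measurable_one
  simp only [Pi.one_apply, mul_one, lintegral_one] at h1
  rw [sphereMeasure, lintegral_smul_measure, hc g hg, h1, smul_eq_mul, zonalConst,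
    ENNReal.mul_inv (Or.inl hc0) (Or.inl hct)]
  set I := ∫⁻ θ in Set.Ioo 0 Real.pi, ENNReal.ofReal (Real.sin θ ^ (d - 2)) * g (Real.cos θ)
  set I₁ := ∫⁻ θ in Set.Ioo 0 Real.pi, ENNReal.ofReal (Real.sin θ ^ (d - 2))
  calc c⁻¹ * I₁⁻¹ * (c * I) = (c⁻¹ * c) * (I₁⁻¹ * I) := by ring
    _ = I₁⁻¹ * I := by rw [ENNReal.inv_mul_cancel hc0 hct, one_mul]

/-! ### Means of radial functions as one-dimensional integrals. -/

/-- The distance from the origin of the point of angle `θ` on a sphere of radius `t` whose centre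
has distance `ρ` from the origin. -/
noncomputable def chord (ρ t θ : ℝ) : ℝ := Real.sqrt (ρ ^ 2 + t ^ 2 - 2 * ρ * t * Real.cos θ)

theorem continuous_chord (ρ t : ℝ) : Continuous (chord ρ t) := by
  unfold chord
  fun_prop

/-- The mean over a sphere of a radial function as a one-dimensional integral. -/
theorem lintegral_sphereMeasure_norm_sub {d : ℕ} (hd : 2 ≤ d) {x : EuclideanSpace ℝ (Fin d)}
    (hx : x ≠ 0) (t : ℝ) {h : ℝ → ℝ≥0∞} (hh : Measurable h) :
    ∫⁻ y, h ‖x - t • (y : EuclideanSpace ℝ (Fin d))‖ ∂(sphereMeasure d) =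
      zonalConst d * ∫⁻ θ in Set.Ioo 0 Real.pi,
        ENNReal.ofReal (Real.sin θ ^ (d - 2)) * h (chord ‖x‖ t θ) := by
  have hx' : ‖x‖ ≠ 0 := norm_ne_zero_iff.2 hx
  have he : ‖‖x‖⁻¹ • x‖ = 1 := by simp [norm_smul, hx']
  refine Eq.trans ?_ (lintegral_sphereMeasure_inner hd he
    (g := fun u => h (Real.sqrt (‖x‖ ^ 2 + t ^ 2 - 2 * ‖x‖ * t * u))) (by fun_prop))
  refine lintegral_congr fun y => congrArg h ?_
  have hy : ‖(y : EuclideanSpace ℝ (Fin d))‖ = 1 := by simp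
  rw [← Real.sqrt_sq (norm_nonneg (x - _))]
  congr 1
  rw [norm_sub_sq_real, norm_smul, hy, inner_smul_right, inner_smul_left]
  simp
  field_simp
  ring

theorem chord_sq {ρ t θ : ℝ} : chord ρ t θ ^ 2 = ρ ^ 2 + t ^ 2 - 2 * ρ * t * Real.cos θ := by
  refine Real.sq_sqrt ?_
  nlinarith [Real.sin_sq_add_cos_sq θ, sq_nonneg (ρ - t * Real.cos θ), sq_nonneg (t * Real.sin θ)]

/-- The squared chord is `(ρ - t cos θ)² + (t sin θ)²`: the distance to the origin is at least the
distance to the axis. -/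
theorem mul_sin_le_chord {ρ t θ : ℝ} : t * Real.sin θ ≤ chord ρ t θ := by
  refine Real.le_sqrt_of_sq_le ?_
  nlinarith [Real.sin_sq_add_cos_sq θ, sq_nonneg (ρ - t * Real.cos θ)]

theorem abs_sub_le_chord {ρ t θ : ℝ} (hρ : 0 ≤ ρ) (ht : 0 ≤ t) : |ρ - t| ≤ chord ρ t θ := by
  refine Real.le_sqrt_of_sq_le ?_
  rw [sq_abs]
  nlinarith [mul_nonneg hρ ht, Real.cos_le_one θ]

theorem chord_le_add {ρ t θ : ℝ} (hρ : 0 ≤ ρ) (ht : 0 ≤ t) : chord ρ t θ ≤ ρ + t := by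
  refine Real.sqrt_le_iff.2 ⟨by positivity, ?_⟩
  nlinarith [mul_nonneg hρ ht, Real.neg_one_le_cos θ]

theorem abs_chord_sub_le {ρ t θ : ℝ} (hρ : 0 ≤ ρ) (ht : 0 ≤ t) : |chord ρ t θ - ρ| ≤ t := by
  have h1 := chord_le_add (θ := θ) hρ ht
  have h2 := abs_sub_le_chord (θ := θ) hρ ht
  rw [abs_le] at h2 ⊢
  constructor <;> linarith [le_abs_self (ρ - t)]

/-- Change of variables from the angle to the distance from the origin. -/
theorem lintegral_chord_le {ρ t : ℝ} (hρ : 0 < ρ) (ht : 0 < t) (G : ℝ → ℝ≥0∞) :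
    ∫⁻ θ in Set.Ioo 0 Real.pi, ENNReal.ofReal (ρ * t * Real.sin θ / chord ρ t θ) *
      G (chord ρ t θ) ≤ ∫⁻ s in Set.Ioi 0 ∩ {s | |s - ρ| ≤ t}, G s := by
  have hpos : ∀ θ ∈ Set.Ioo 0 Real.pi, 0 < chord ρ t θ := fun θ hθ =>
    (mul_pos ht (Real.sin_pos_of_mem_Ioo hθ)).trans_le mul_sin_le_chord
  have hder : ∀ θ ∈ Set.Ioo 0 Real.pi, HasDerivWithinAt (chord ρ t)
      (ρ * t * Real.sin θ / chord ρ t θ) (Set.Ioo 0 Real.pi) θ := by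
    intro θ hθ
    have h0 : ρ ^ 2 + t ^ 2 - 2 * ρ * t * Real.cos θ ≠ 0 := by
      rw [← chord_sq]
      exact (pow_pos (hpos θ hθ) 2).ne'
    have h1 : HasDerivAt (fun θ => ρ ^ 2 + t ^ 2 - 2 * ρ * t * Real.cos θ)
        (2 * ρ * t * Real.sin θ) θ := by
      have := ((Real.hasDerivAt_cos θ).const_mul (2 * ρ * t)).const_sub (ρ ^ 2 + t ^ 2)
      exact this.congr_deriv (by ring)
    have h2 := (h1.sqrt h0).hasDerivWithinAt (s := Set.Ioo 0 Real.pi)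
    refine h2.congr_deriv ?_
    rw [chord, show 2 * ρ * t * Real.sin θ = 2 * (ρ * t * Real.sin θ) by ring,
      mul_div_mul_left _ _ two_ne_zero]
  have hinj : Set.InjOn (chord ρ t) (Set.Ioo 0 Real.pi) := by
    intro a ha b hb hab
    have h1 := congrArg (· ^ 2) hab
    simp only [chord_sq] at h1
    refine Real.injOn_cos ⟨ha.1.le, ha.2.le⟩ ⟨hb.1.le, hb.2.le⟩ ?_
    have h2 : 2 * ρ * t * (Real.cos a - Real.cos b) = 0 := by linarith
    have h3 : 2 * ρ * t ≠ 0 := by positivity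
    linarith [(mul_eq_zero.1 h2).resolve_left h3]
  have key := lintegral_image_eq_lintegral_abs_deriv_mul measurableSet_Ioo hder hinj G
  have hc : ∫⁻ θ in Set.Ioo 0 Real.pi, ENNReal.ofReal (ρ * t * Real.sin θ / chord ρ t θ) *
      G (chord ρ t θ) = ∫⁻ s in chord ρ t '' Set.Ioo 0 Real.pi, G s := by
    rw [key]
    refine setLIntegral_congr_fun measurableSet_Ioo fun θ hθ => ?_
    have := (Real.sin_pos_of_mem_Ioo hθ).le
    have := (hpos θ hθ).le
    have : 0 ≤ ρ * t * Real.sin θ / chord ρ t θ := by positivity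
    rw [abs_of_nonneg this]
  rw [hc]
  refine lintegral_mono_set ?_
  rintro _ ⟨θ, hθ, rfl⟩
  exact ⟨hpos θ hθ, abs_chord_sub_le hρ.le ht.le⟩

/-! ### Bounds for a single mean by an integral over an annulus. -/

theorem lintegral_sin_rpow_lt_top {α : ℝ} (hα : -1 < α) :
    ∫⁻ θ in Set.Ioo 0 Real.pi, ENNReal.ofReal (Real.sin θ ^ α) < ∞ := by
  have hpi := Real.pi_pos
  have hhalf : ∫⁻ θ in Set.Ioo 0 (Real.pi / 2), ENNReal.ofReal (Real.sin θ ^ α) < ∞ := by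
    have hbound : ∀ θ ∈ Set.Ioo 0 (Real.pi / 2),
        ENNReal.ofReal (Real.sin θ ^ α) ≤ ENNReal.ofReal (1 + (2 / Real.pi) ^ α * θ ^ α) := by
      intro θ hθ
      refine ENNReal.ofReal_le_ofReal ?_
      have hs : 0 < Real.sin θ := Real.sin_pos_of_pos_of_lt_pi hθ.1 (by linarith [hθ.2])
      have hθ0 := hθ.1
      rcases le_or_gt 0 α with h | h
      · have : Real.sin θ ^ α ≤ 1 := Real.rpow_le_one hs.le (Real.sin_le_one θ) h
        have : 0 ≤ (2 / Real.pi) ^ α * θ ^ α := by positivity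
        linarith
      · have h2 : 2 / Real.pi * θ ≤ Real.sin θ := Real.mul_le_sin hθ.1.le hθ.2.le
        have := Real.rpow_le_rpow_of_nonpos (by positivity) h2 h.le
        rw [Real.mul_rpow (by positivity) hθ.1.le] at this
        linarith
    refine (setLIntegral_mono (by fun_prop) hbound).trans_lt ?_
    have hint : IntegrableOn (fun θ : ℝ => 1 + (2 / Real.pi) ^ α * θ ^ α)
        (Set.Ioo 0 (Real.pi / 2)) := by
      have h1 := (intervalIntegral.intervalIntegrable_rpow' (a := 0) (b := Real.pi / 2) hα)
      rw [intervalIntegrable_iff_integrableOn_Ioo_of_le (by positivity)] at h1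
      exact (integrableOn_const (by simp)).add (h1.const_mul _)
    exact hint.lintegral_lt_top
  have hrefl : ∫⁻ θ in Set.Ioo (Real.pi / 2) Real.pi, ENNReal.ofReal (Real.sin θ ^ α) =
      ∫⁻ θ in Set.Ioo 0 (Real.pi / 2), ENNReal.ofReal (Real.sin θ ^ α) := by
    have hmp : MeasurePreserving (fun θ : ℝ => Real.pi - θ) volume volume :=
      Measure.measurePreserving_sub_left volume Real.pi
    have := hmp.setLIntegral_comp_preimage (measurableSet_Ioo (a := 0) (b := Real.pi / 2))
      (f := fun θ => ENNReal.ofReal (Real.sin θ ^ α)) (by fun_prop)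
    simp only [Real.sin_pi_sub, Set.preimage_const_sub_Ioo] at this
    rw [← this]
    congr 2
    congr 1 <;> ring_nf
  have hae : (Set.Ioo 0 Real.pi : Set ℝ) ⊆
      Set.Ioo 0 (Real.pi / 2) ∪ ({Real.pi / 2} ∪ Set.Ioo (Real.pi / 2) Real.pi) := by
    intro θ hθ
    rcases lt_trichotomy θ (Real.pi / 2) with h | h | h
    · exact Or.inl ⟨hθ.1, h⟩
    · exact Or.inr (Or.inl h)
    · exact Or.inr (Or.inr ⟨h, hθ.2⟩)
  calc _ ≤ _ := lintegral_mono_set hae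
    _ ≤ _ := lintegral_union_le _ _ _
    _ ≤ _ := add_le_add_right (lintegral_union_le _ _ _) _
    _ < ∞ := by
      rw [hrefl]
      simp [hhalf]

/-- Hölder after writing `sin^(d-2) = sin^β · sin^(d-2-β)`. The first factor, raised to the power
`p`, carries `sin^(d-1)`: one sine is the Jacobian of the chord substitution and the other `d - 2`
are absorbed by `m sin θ ≤ chord`. The parameter `m` is left free so that it can grow with `ρ` far
from the origin. -/
theorem lintegral_sin_mul_chord_le {d : ℕ} (hd : 2 ≤ d) {p : ℝ} (hp : d < ((d : ℝ) - 1) * p) :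
    ∃ B : ℝ≥0∞, B ≠ ∞ ∧ ∀ ρ t m : ℝ, 0 < ρ → 0 < t → 0 < m →
      (∀ θ ∈ Set.Ioo 0 Real.pi, m * Real.sin θ ≤ chord ρ t θ) → ∀ h : ℝ → ℝ≥0∞, Measurable h →
      ∫⁻ θ in Set.Ioo 0 Real.pi, ENNReal.ofReal (Real.sin θ ^ (d - 2)) * h (chord ρ t θ) ≤
        B * (ENNReal.ofReal (m ^ (d - 2) * (ρ * t))⁻¹ *
          ∫⁻ s in Set.Ioi 0 ∩ {s | |s - ρ| ≤ t},
            ENNReal.ofReal (s ^ (d - 1)) * h s ^ p) ^ (1 / p) := by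
  have hd' : (2 : ℝ) ≤ d := by exact_mod_cast hd
  have hp1 : 1 < p := by nlinarith
  have hp0 : 0 < p := by linarith
  set q := p.conjExponent
  have hpq : p.HolderConjugate q := Real.HolderConjugate.conjExponent hp1
  -- With `β p = d - 1`, the remaining power `α` of the sine exceeds `-1`, hence is integrable,
  -- precisely when `p > d / (d - 1)`.
  set β := ((d : ℝ) - 1) / p
  set α := ((d : ℝ) - 2 - β) * q
  have hα : -1 < α := by
    have : α = (((d : ℝ) - 2) * p - (d - 1)) / (p - 1) := by
      simp only [α, β, q, Real.conjExponent]
      have : p - 1 ≠ 0 := by linarith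
      field_simp
    rw [this, lt_div_iff₀ (by linarith)]
    nlinarith
  refine ⟨(∫⁻ θ in Set.Ioo 0 Real.pi, ENNReal.ofReal (Real.sin θ ^ α)) ^ (1 / q),
    ENNReal.rpow_ne_top_of_nonneg (by have := hpq.symm.pos; positivity)
      (lintegral_sin_rpow_lt_top hα).ne, ?_⟩
  intro ρ t m hρ ht hm hchord h hh
  have hch : Measurable (chord ρ t) := (continuous_chord ρ t).measurable
  have hH := ENNReal.lintegral_mul_le_Lp_mul_Lq (volume.restrict (Set.Ioo 0 Real.pi)) hpq
    (f := fun θ => ENNReal.ofReal (Real.sin θ ^ β) * h (chord ρ t θ))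
    (g := fun θ => ENNReal.ofReal (Real.sin θ ^ ((d : ℝ) - 2 - β)))
    (by fun_prop) (by fun_prop)
  have h1 : ∫⁻ θ in Set.Ioo 0 Real.pi, ENNReal.ofReal (Real.sin θ ^ (d - 2)) * h (chord ρ t θ) =
      ∫⁻ θ in Set.Ioo 0 Real.pi, ((fun θ => ENNReal.ofReal (Real.sin θ ^ β) * h (chord ρ t θ)) *
        (fun θ => ENNReal.ofReal (Real.sin θ ^ ((d : ℝ) - 2 - β)))) θ := by
    refine setLIntegral_congr_fun measurableSet_Ioo fun θ hθ => ?_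
    have hs := Real.sin_pos_of_mem_Ioo hθ
    have h2 : Real.sin θ ^ (d - 2) = Real.sin θ ^ β * Real.sin θ ^ ((d : ℝ) - 2 - β) := by
      rw [← Real.rpow_add hs, ← Real.rpow_natCast, Nat.cast_sub hd]
      congr 1
      push_cast
      ring
    simp only [Pi.mul_apply]
    rw [h2, ENNReal.ofReal_mul (by positivity)]
    ring
  have h3 : ∫⁻ θ in Set.Ioo 0 Real.pi, ENNReal.ofReal (Real.sin θ ^ ((d : ℝ) - 2 - β)) ^ q =
      ∫⁻ θ in Set.Ioo 0 Real.pi, ENNReal.ofReal (Real.sin θ ^ α) := by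
    refine setLIntegral_congr_fun measurableSet_Ioo fun θ hθ => ?_
    have hs := Real.sin_pos_of_mem_Ioo hθ
    simp only [α]
    rw [ENNReal.ofReal_rpow_of_pos (by positivity), ← Real.rpow_mul hs.le]
  have h4 : ∫⁻ θ in Set.Ioo 0 Real.pi, (ENNReal.ofReal (Real.sin θ ^ β) * h (chord ρ t θ)) ^ p ≤
      ENNReal.ofReal (m ^ (d - 2) * (ρ * t))⁻¹ *
        ∫⁻ s in Set.Ioi 0 ∩ {s | |s - ρ| ≤ t}, ENNReal.ofReal (s ^ (d - 1)) * h s ^ p := by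
    refine le_trans ?_ (mul_le_mul_right (lintegral_chord_le hρ ht
      (fun s => ENNReal.ofReal (s ^ (d - 1)) * h s ^ p)) _)
    rw [← lintegral_const_mul _ (by fun_prop)]
    refine setLIntegral_mono (by fun_prop) fun θ hθ => ?_
    have hs := Real.sin_pos_of_mem_Ioo hθ
    have hc0 : 0 < chord ρ t θ := (mul_pos hm hs).trans_le (hchord θ hθ)
    rw [ENNReal.mul_rpow_of_nonneg _ _ hp0.le, ENNReal.ofReal_rpow_of_pos (by positivity),
      ← Real.rpow_mul hs.le, ← mul_assoc, ← mul_assoc, ← ENNReal.ofReal_mul (by positivity),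
      ← ENNReal.ofReal_mul (by positivity)]
    refine mul_le_mul_left (ENNReal.ofReal_le_ofReal ?_) _
    have h5 : Real.sin θ ^ (β * p) = Real.sin θ ^ (d - 2) * Real.sin θ := by
      rw [← pow_succ, show d - 2 + 1 = d - 1 by omega, ← Real.rpow_natCast,
        Nat.cast_sub (by omega : 1 ≤ d)]
      congr 1
      simp only [β]
      push_cast
      field_simp
    have h6 : (m * Real.sin θ) ^ (d - 2) ≤ chord ρ t θ ^ (d - 2) :=
      pow_le_pow_left₀ (by positivity) (hchord θ hθ) _
    have h7 : (m ^ (d - 2) * (ρ * t))⁻¹ * (ρ * t * Real.sin θ / chord ρ t θ) *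
        chord ρ t θ ^ (d - 1) = (m ^ (d - 2))⁻¹ * (chord ρ t θ ^ (d - 2) * Real.sin θ) := by
      rw [show d - 1 = d - 2 + 1 by omega, pow_succ]
      field_simp
    rw [h5, h7, ← div_eq_inv_mul, le_div_iff₀ (by positivity)]
    rw [mul_pow] at h6
    nlinarith
  rw [h1, mul_comm _ (_ ^ (1 / p))]
  refine hH.trans ?_
  rw [h3]
  exact mul_le_mul_left (ENNReal.rpow_le_rpow h4 (by positivity)) _

theorem setLIntegral_comp_norm {d : ℕ} (hd : 2 ≤ d) {S : Set ℝ} (hS : MeasurableSet S)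
    {h : ℝ → ℝ≥0∞} (hh : Measurable h) :
    ∫⁻ s in Set.Ioi 0 ∩ S, ENNReal.ofReal (s ^ (d - 1)) * h s =
      ((volume : Measure (EuclideanSpace ℝ (Fin d))).toSphere Set.univ)⁻¹ *
        ∫⁻ z : EuclideanSpace ℝ (Fin d) in {z | ‖z‖ ∈ S}, h ‖z‖ := by
  have := nontrivial_euclidean hd
  have hS' : MeasurableSet {z : EuclideanSpace ℝ (Fin d) | ‖z‖ ∈ S} := measurable_norm hS
  rw [← lintegral_indicator hS']
  have h1 := lintegral_comp_norm (volume : Measure (EuclideanSpace ℝ (Fin d)))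
    (hh.indicator hS)
  rw [show (fun z : EuclideanSpace ℝ (Fin d) => {z | ‖z‖ ∈ S}.indicator (fun z => h ‖z‖) z) =
    fun z => S.indicator h ‖z‖ from rfl, h1, ← mul_assoc,
    ENNReal.inv_mul_cancel (toSphere_univ_ne_zero hd) (measure_ne_top _ _), one_mul,
    Set.inter_comm, ← Measure.restrict_restrict hS, ← lintegral_indicator hS]
  refine lintegral_congr fun s => ?_
  by_cases hs : s ∈ S <;> simp [hs]

/-- Spherical means of radial functions are controlled by the `L^p` norm over an annulus. -/
theorem lintegral_sphere_le_annulus {d : ℕ} (hd : 2 ≤ d) {p : ℝ} (hp : d < ((d : ℝ) - 1) * p) :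
    ∃ B : ℝ≥0∞, B ≠ ∞ ∧ ∀ (x : EuclideanSpace ℝ (Fin d)) (t m : ℝ), x ≠ 0 → 0 < t → 0 < m →
      (∀ θ ∈ Set.Ioo 0 Real.pi, m * Real.sin θ ≤ chord ‖x‖ t θ) →
      ∀ h : ℝ → ℝ≥0∞, Measurable h →
      ∫⁻ y, h ‖x - t • (y : EuclideanSpace ℝ (Fin d))‖ ∂(sphereMeasure d) ≤
        B * (ENNReal.ofReal (m ^ (d - 2) * (‖x‖ * t))⁻¹ *
          ∫⁻ z : EuclideanSpace ℝ (Fin d) in {z | |‖z‖ - ‖x‖| ≤ t}, h ‖z‖ ^ p) ^ (1 / p) := by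
  have hd' : (2 : ℝ) ≤ d := by exact_mod_cast hd
  have hp0 : 0 < p := by nlinarith
  obtain ⟨B, hB, H⟩ := lintegral_sin_mul_chord_le hd hp
  set c := (volume : Measure (EuclideanSpace ℝ (Fin d))).toSphere Set.univ
  refine ⟨zonalConst d * B * (c⁻¹) ^ (1 / p), ?_, fun x t m hx ht hm hc h hh => ?_⟩
  · exact ENNReal.mul_ne_top (ENNReal.mul_ne_top (zonalConst_ne_zero_and_ne_top hd).2 hB)
      (ENNReal.rpow_ne_top_of_nonneg (by positivity)
        (ENNReal.inv_ne_top.2 (toSphere_univ_ne_zero hd)))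
  rw [lintegral_sphereMeasure_norm_sub hd hx t hh]
  refine (mul_le_mul_right (H ‖x‖ t m (norm_pos_iff.2 hx) ht hm hc h hh) _).trans (le_of_eq ?_)
  rw [setLIntegral_comp_norm hd (S := {s | |s - ‖x‖| ≤ t})
    (measurableSet_le (by fun_prop) (by fun_prop)) (h := fun s => h s ^ p) (by fun_prop)]
  simp only [Set.mem_ofPred_eq]
  rw [mul_left_comm _ (c⁻¹), ENNReal.mul_rpow_of_nonneg (c⁻¹) _ (by positivity)]
  ring

/-! ### Interpolation between weak type and the trivial bound at infinity. -/

/-- This is the integral over the levels that remains after Fubini in the layer-cake formula: only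
levels `l < 2 a` contribute. -/
theorem lintegral_rpow_Ioo_le {s : ℝ} (hs : 0 < s) (a : ℝ≥0∞) :
    ∫⁻ l in Set.Ioi (0 : ℝ), {l | ENNReal.ofReal (l / 2) < a}.indicator
      (fun l => ENNReal.ofReal (l ^ (s - 1))) l ≤ ENNReal.ofReal (2 ^ s / s) * a ^ s := by
  rcases eq_or_ne a ∞ with rfl | ha
  · rw [ENNReal.top_rpow_of_pos hs, ENNReal.mul_top]
    · exact le_top
    · exact (ENNReal.ofReal_pos.2 (by positivity)).ne'
  lift a to ℝ≥0 using ha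
  have hsub : {l : ℝ | ENNReal.ofReal (l / 2) < (a : ℝ≥0∞)} ∩ Set.Ioi 0 ⊆ Set.Ioc 0 (2 * a) := by
    rintro l ⟨h1, h2⟩
    refine ⟨h2, ?_⟩
    have h3 : ENNReal.ofReal (l / 2) < (a : ℝ≥0∞) := h1
    rw [ENNReal.ofReal_lt_coe_iff (by have : 0 < l := h2; positivity)] at h3
    linarith
  have hmeas : MeasurableSet {l : ℝ | ENNReal.ofReal (l / 2) < (a : ℝ≥0∞)} :=
    measurableSet_lt (by fun_prop) measurable_const
  rw [lintegral_indicator hmeas, Measure.restrict_restrict hmeas]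
  refine (lintegral_mono_set hsub).trans ?_
  have hint : IntegrableOn (fun l : ℝ => l ^ (s - 1)) (Set.Ioc 0 (2 * a)) := by
    have h1 := (intervalIntegral.intervalIntegrable_rpow' (a := 0) (b := 2 * a)
      (r := s - 1) (by linarith))
    rwa [intervalIntegrable_iff_integrableOn_Ioc_of_le (by positivity)] at h1
  rw [← ofReal_integral_eq_lintegral_ofReal hint]
  · rw [← intervalIntegral.integral_of_le (by positivity), integral_rpow (Or.inl (by linarith)),
      sub_add_cancel, Real.zero_rpow hs.ne', sub_zero, Real.mul_rpow (by norm_num) a.coe_nonneg,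
      ← ENNReal.ofReal_coe_nnreal, ENNReal.ofReal_rpow_of_nonneg a.coe_nonneg hs.le,
      ← ENNReal.ofReal_mul (by positivity)]
    refine le_of_eq (congrArg _ ?_)
    ring
  · filter_upwards [ae_restrict_mem measurableSet_Ioc] with l hl
    have := hl.1
    simp only [Pi.zero_apply]
    positivity

/-- An off-diagonal Marcinkiewicz interpolation: weak type estimates with exponent `p₀` for the
part of `h` above the height `λ / 2` give a strong type estimate for exponents `p > p₀`. -/
theorem lintegral_rpow_le_of_weak {X Y : Type*} [MeasurableSpace X] [MeasurableSpace Y]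
    (μ : Measure X) (ν : Measure Y) [SFinite ν] {p₀ p k : ℝ} (hp₀ : 0 < p₀) (hp : p₀ < p)
    (hk : 1 ≤ k) {K : ℝ≥0∞} (hK : K ≠ ∞) :
    ∃ C : ℝ≥0∞, C ≠ ∞ ∧ ∀ (G : X → ℝ≥0∞) (h : Y → ℝ≥0∞), AEMeasurable G μ → Measurable h →
      (∀ᵐ x ∂μ, G x ≠ ∞) →
      (∀ l : ℝ, 0 < l → μ {x | ENNReal.ofReal l < G x} ≤
        K * (ENNReal.ofReal (l ^ (-p₀)) * ∫⁻ y in {y | ENNReal.ofReal (l / 2) < h y},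
          h y ^ p₀ ∂ν) ^ k) →
      ∫⁻ x, G x ^ (k * p) ∂μ ≤ C * (∫⁻ y, h y ^ p ∂ν) ^ k := by
  set s := p - p₀
  have hs : 0 < s := sub_pos.2 hp
  have hkp : 0 < k * p := by have : 0 < p := hp₀.trans hp; positivity
  refine ⟨ENNReal.ofReal (k * p) * (K * ENNReal.ofReal (2 ^ (s * (k - 1))) *
    ENNReal.ofReal (2 ^ s / s)), by finiteness, ?_⟩
  intro G h hG hh hGt hweak
  set B := ∫⁻ y, h y ^ p ∂ν
  set I : ℝ → ℝ≥0∞ := fun l => ∫⁻ y in {y | ENNReal.ofReal (l / 2) < h y}, h y ^ p₀ ∂ν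
  have hlev : ∀ l : ℝ, MeasurableSet {y | ENNReal.ofReal (l / 2) < h y} := fun l =>
    measurableSet_lt measurable_const hh
  have hpow : ∀ y, h y ^ p = h y ^ p₀ * h y ^ s := fun y => by
    rw [← ENNReal.rpow_add_of_nonneg _ _ hp₀.le hs.le]
    congr 1
    simp [s]
  -- Chebyshev: where `h > l / 2`, the surplus power `h ^ s` is at least `(l / 2) ^ s`.
  have hI : ∀ l : ℝ, 0 < l → I l ≤ ENNReal.ofReal ((l / 2) ^ (-s)) * B := by
    intro l hl
    have h1 : I l * ENNReal.ofReal ((l / 2) ^ s) ≤ B := by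
      rw [← lintegral_mul_const _ (by fun_prop)]
      refine (setLIntegral_mono (g := fun y => h y ^ p) (by fun_prop) fun y hy => ?_).trans
        (setLIntegral_le_lintegral _ _)
      rw [hpow, ← ENNReal.ofReal_rpow_of_pos (by positivity)]
      exact mul_le_mul_right (ENNReal.rpow_le_rpow (le_of_lt hy) hs.le) _
    rw [Real.rpow_neg (by positivity), ENNReal.ofReal_inv_of_pos (by positivity), mul_comm,
      ← div_eq_mul_inv]
    exact ENNReal.le_div_iff_mul_le (Or.inl (by simp; positivity)) (Or.inl (by simp)) |>.2 h1
  have hlayer : ∫⁻ x, G x ^ (k * p) ∂μ = ENNReal.ofReal (k * p) *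
      ∫⁻ l in Set.Ioi 0, μ {x | l < (G x).toReal} * ENNReal.ofReal (l ^ (k * p - 1)) := by
    rw [← lintegral_rpow_eq_lintegral_meas_lt_mul μ (Filter.Eventually.of_forall fun x =>
      ENNReal.toReal_nonneg) hG.ennreal_toReal hkp]
    refine lintegral_congr_ae ?_
    filter_upwards [hGt] with x hx
    rw [← ENNReal.ofReal_rpow_of_nonneg ENNReal.toReal_nonneg hkp.le, ENNReal.ofReal_toReal hx]
  have hpt : ∀ l ∈ Set.Ioi (0 : ℝ), μ {x | l < (G x).toReal} * ENNReal.ofReal (l ^ (k * p - 1)) ≤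
      (K * ENNReal.ofReal (2 ^ (s * (k - 1))) * B ^ (k - 1)) *
        (ENNReal.ofReal (l ^ (s - 1)) * I l) := by
    intro l hl
    have hl0 : 0 < l := hl
    have h1 : μ {x | l < (G x).toReal} ≤ K * (ENNReal.ofReal (l ^ (-p₀)) * I l) ^ k := by
      refine (measure_mono fun x hx => ?_).trans (hweak l hl0)
      exact (ENNReal.ofReal_lt_iff_lt_toReal hl0.le
        (fun h => by simp [h] at hx; exact absurd hx (not_lt.2 hl0.le))).2 hx
    -- Chebyshev is spent on `k - 1` of the `k` powers of `I l`; one power is kept, linear in the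
    -- measure `ν`, for Fubini.
    have h2 : (ENNReal.ofReal (l ^ (-p₀)) * I l) ^ k ≤ ENNReal.ofReal (l ^ (-p₀)) ^ k *
        ((ENNReal.ofReal ((l / 2) ^ (-s)) * B) ^ (k - 1) * I l) := by
      rw [ENNReal.mul_rpow_of_nonneg _ _ (by linarith)]
      refine mul_le_mul_right ?_ _
      calc I l ^ k = I l ^ (k - 1) * I l := by
            conv_rhs => rw [← ENNReal.rpow_one (I l), ← ENNReal.rpow_mul,
              ← ENNReal.rpow_add_of_nonneg _ _ (by linarith) (by norm_num)]
            congr 1; ring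
        _ ≤ _ := mul_le_mul_left (ENNReal.rpow_le_rpow (hI l hl0) (by linarith)) _
    -- The exponents of `l` add up to `-p₀ k - s (k - 1) + k p - 1 = s - 1`, because `s = p - p₀`.
    have h3 : ENNReal.ofReal (l ^ (-p₀)) ^ k * ENNReal.ofReal ((l / 2) ^ (-s)) ^ (k - 1) *
        ENNReal.ofReal (l ^ (k * p - 1)) =
        ENNReal.ofReal (2 ^ (s * (k - 1))) * ENNReal.ofReal (l ^ (s - 1)) := by
      rw [ENNReal.ofReal_rpow_of_pos (by positivity), ENNReal.ofReal_rpow_of_pos (by positivity),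
        ← ENNReal.ofReal_mul (by positivity), ← ENNReal.ofReal_mul (by positivity),
        ← ENNReal.ofReal_mul (by positivity)]
      congr 1
      rw [Real.div_rpow hl0.le (by norm_num), Real.div_rpow (by positivity) (by positivity),
        ← Real.rpow_mul hl0.le, ← Real.rpow_mul hl0.le, ← Real.rpow_mul (by norm_num),
        show -s * (k - 1) = -(s * (k - 1)) by ring, Real.rpow_neg (by norm_num : (0 : ℝ) ≤ 2),
        div_inv_eq_mul]
      rw [show l ^ (-p₀ * k) * (l ^ (-(s * (k - 1))) * 2 ^ (s * (k - 1))) * l ^ (k * p - 1) =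
        2 ^ (s * (k - 1)) * (l ^ (-p₀ * k) * l ^ (-(s * (k - 1))) * l ^ (k * p - 1)) by ring,
        ← Real.rpow_add hl0, ← Real.rpow_add hl0]
      congr 2
      simp only [s]
      ring
    calc _ ≤ K * (ENNReal.ofReal (l ^ (-p₀)) ^ k *
          ((ENNReal.ofReal ((l / 2) ^ (-s)) * B) ^ (k - 1) * I l)) *
            ENNReal.ofReal (l ^ (k * p - 1)) :=
          mul_le_mul_left (h1.trans (mul_le_mul_right h2 _)) _
      _ = K * (ENNReal.ofReal (l ^ (-p₀)) ^ k * ENNReal.ofReal ((l / 2) ^ (-s)) ^ (k - 1) *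
        ENNReal.ofReal (l ^ (k * p - 1))) * B ^ (k - 1) * I l := by
          rw [ENNReal.mul_rpow_of_nonneg _ _ (by linarith)]
          ring
      _ = _ := by
          rw [h3]
          ring
  have hjoint : Measurable (Function.uncurry fun (l : ℝ) (y : Y) =>
      {l | ENNReal.ofReal (l / 2) < h y}.indicator (fun l => ENNReal.ofReal (l ^ (s - 1))) l *
        h y ^ p₀) := by
    have hset : MeasurableSet {z : ℝ × Y | ENNReal.ofReal (z.1 / 2) < h z.2} :=
      measurableSet_lt (by fun_prop) (by fun_prop)
    have h1 : Measurable fun z : ℝ × Y => {z : ℝ × Y | ENNReal.ofReal (z.1 / 2) < h z.2}.indicator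
      (fun z => ENNReal.ofReal (z.1 ^ (s - 1))) z :=
      Measurable.indicator (by fun_prop) hset
    exact h1.mul (by fun_prop)
  have hswap : ∫⁻ l in Set.Ioi (0 : ℝ), ENNReal.ofReal (l ^ (s - 1)) * I l ≤
      ENNReal.ofReal (2 ^ s / s) * B := by
    calc _ = ∫⁻ l in Set.Ioi (0 : ℝ), ∫⁻ y, {l | ENNReal.ofReal (l / 2) < h y}.indicator
          (fun l => ENNReal.ofReal (l ^ (s - 1))) l * h y ^ p₀ ∂ν := by
          refine lintegral_congr fun l => ?_
          rw [← lintegral_const_mul _ (by fun_prop), ← lintegral_indicator (hlev l)]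
          refine lintegral_congr fun y => ?_
          by_cases hy : ENNReal.ofReal (l / 2) < h y <;> simp [hy]
      _ = ∫⁻ y, (∫⁻ l in Set.Ioi (0 : ℝ), {l | ENNReal.ofReal (l / 2) < h y}.indicator
          (fun l => ENNReal.ofReal (l ^ (s - 1))) l * h y ^ p₀) ∂ν :=
          lintegral_lintegral_swap hjoint.aemeasurable
      _ ≤ ∫⁻ y, ENNReal.ofReal (2 ^ s / s) * h y ^ p ∂ν := by
          refine lintegral_mono fun y => ?_
          rw [lintegral_mul_const _ (Measurable.indicator (by fun_prop)
            (measurableSet_lt (by fun_prop) measurable_const)), hpow, mul_comm (h y ^ p₀),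
            ← mul_assoc]
          exact mul_le_mul_left (lintegral_rpow_Ioo_le hs _) _
      _ = _ := lintegral_const_mul _ (by fun_prop)
  have hmeasI : Measurable fun l : ℝ => ENNReal.ofReal (l ^ (s - 1)) * I l := by
    have hset : MeasurableSet {z : ℝ × Y | ENNReal.ofReal (z.1 / 2) < h z.2} :=
      measurableSet_lt (by fun_prop) (by fun_prop)
    have h1 : Measurable fun z : ℝ × Y => {z : ℝ × Y | ENNReal.ofReal (z.1 / 2) < h z.2}.indicator
      (fun z => h z.2 ^ p₀) z := Measurable.indicator (by fun_prop) hset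
    have h2 : I = fun l => ∫⁻ y, {z : ℝ × Y | ENNReal.ofReal (z.1 / 2) < h z.2}.indicator
        (fun z => h z.2 ^ p₀) (l, y) ∂ν := by
      funext l
      exact (lintegral_indicator (hlev l) _).symm
    have h3 : Measurable I := h2 ▸ h1.lintegral_prod_right'
    fun_prop
  rw [hlayer, mul_assoc]
  refine mul_le_mul_right ?_ _
  refine (setLIntegral_mono (by fun_prop) hpt).trans ?_
  rw [lintegral_const_mul _ hmeasI]
  refine (mul_le_mul_right hswap _).trans (le_of_eq ?_)
  have hB : B ^ k = B ^ (k - 1) * B := by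
    conv_rhs => rw [← ENNReal.rpow_one B, ← ENNReal.rpow_mul,
      ← ENNReal.rpow_add_of_nonneg _ _ (by linarith) (by norm_num)]
    congr 1; ring
  rw [hB]
  ring

/-! ### Pointwise, weak type and strong type bounds for the maximal function. -/

/-- The maximal function over `t ∈ [1, 2]` of the means of the radial function `h ‖·‖`. -/
noncomputable def radialMaximal {d : ℕ} (h : ℝ → ℝ≥0∞) (x : EuclideanSpace ℝ (Fin d)) : ℝ≥0∞ :=
  ⨆ t ∈ Set.Icc (1 : ℝ) 2, ∫⁻ y, h ‖x - t • (y : EuclideanSpace ℝ (Fin d))‖ ∂(sphereMeasure d)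

/-- The annulus bound with `m = 1`, which is admissible because `t ≥ 1`. It holds at every `x ≠ 0`
and so also supplies finiteness and null-set arguments. -/
theorem radialMaximal_le_near {d : ℕ} (hd : 2 ≤ d) {p : ℝ} (hp : d < ((d : ℝ) - 1) * p) :
    ∃ B : ℝ≥0∞, B ≠ ∞ ∧ ∀ (x : EuclideanSpace ℝ (Fin d)), x ≠ 0 →
      ∀ h : ℝ → ℝ≥0∞, Measurable h → radialMaximal h x ≤
        B * (ENNReal.ofReal ‖x‖⁻¹ * ∫⁻ z : EuclideanSpace ℝ (Fin d), h ‖z‖ ^ p) ^ (1 / p) := by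
  have hd' : (2 : ℝ) ≤ d := by exact_mod_cast hd
  have hp0 : 0 < p := by nlinarith
  obtain ⟨B, hB, H⟩ := lintegral_sphere_le_annulus hd hp
  refine ⟨B, hB, fun x hx h hh => iSup₂_le fun t ht => ?_⟩
  have ht0 : 0 < t := by linarith [ht.1]
  have hx0 : 0 < ‖x‖ := norm_pos_iff.2 hx
  refine (H x t 1 hx ht0 one_pos (fun θ hθ => ?_) h hh).trans ?_
  · have hs := Real.sin_pos_of_mem_Ioo hθ
    have := mul_sin_le_chord (ρ := ‖x‖) (t := t) (θ := θ)
    nlinarith [ht.1]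
  · refine mul_le_mul_right (ENNReal.rpow_le_rpow (mul_le_mul' (ENNReal.ofReal_le_ofReal ?_)
      (setLIntegral_le_lintegral _ _)) (by positivity)) _
    rw [one_pow, one_mul]
    exact inv_anti₀ hx0 (le_mul_of_one_le_right hx0.le ht.1)

/-- Here the whole sphere stays at distance at least `‖x‖ - 2 ≥ ‖x‖ / 2` from the origin, so `m =
‖x‖ / 2` is admissible. -/
theorem radialMaximal_le_far {d : ℕ} (hd : 2 ≤ d) {p : ℝ} (hp : d < ((d : ℝ) - 1) * p) :
    ∃ B : ℝ≥0∞, B ≠ ∞ ∧ ∀ (x : EuclideanSpace ℝ (Fin d)), 4 ≤ ‖x‖ →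
      ∀ h : ℝ → ℝ≥0∞, Measurable h → radialMaximal h x ≤
        B * (ENNReal.ofReal (‖x‖ ^ (d - 1))⁻¹ *
          ∫⁻ z : EuclideanSpace ℝ (Fin d) in {z | |‖z‖ - ‖x‖| ≤ 2}, h ‖z‖ ^ p) ^ (1 / p) := by
  have hd' : (2 : ℝ) ≤ d := by exact_mod_cast hd
  have hp0 : 0 < p := by nlinarith
  obtain ⟨B, hB, H⟩ := lintegral_sphere_le_annulus hd hp
  refine ⟨B * ENNReal.ofReal (2 ^ (d - 2)) ^ (1 / p), ?_, fun x hx h hh => iSup₂_le fun t ht => ?_⟩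
  · exact ENNReal.mul_ne_top hB (ENNReal.rpow_ne_top_of_nonneg (by positivity) (by finiteness))
  have ht0 : 0 < t := by linarith [ht.1]
  have hx0 : 0 < ‖x‖ := by linarith
  refine (H x t (‖x‖ / 2) (norm_pos_iff.1 hx0) ht0 (by positivity) (fun θ hθ => ?_) h hh).trans ?_
  · have hs := Real.sin_pos_of_mem_Ioo hθ
    have h1 := abs_sub_le_chord (θ := θ) hx0.le ht0.le
    have h2 := le_abs_self (‖x‖ - t)
    have h3 := Real.sin_le_one θ
    have h4 : ‖x‖ / 2 * Real.sin θ ≤ ‖x‖ / 2 := mul_le_of_le_one_right (by positivity) h3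
    linarith [ht.2]
  · rw [mul_assoc B, ← ENNReal.mul_rpow_of_nonneg _ _ (by positivity),
      ← mul_assoc (ENNReal.ofReal (2 ^ (d - 2))), ← ENNReal.ofReal_mul (by positivity)]
    refine mul_le_mul_right (ENNReal.rpow_le_rpow (mul_le_mul' (ENNReal.ofReal_le_ofReal ?_)
      (lintegral_mono_set fun z (hz : |‖z‖ - ‖x‖| ≤ t) => hz.trans ht.2)) (by positivity)) _
    rw [div_pow, show d - 1 = d - 2 + 1 by omega, pow_succ, div_mul_eq_mul_div, inv_div,
      div_eq_mul_inv]
    refine mul_le_mul_of_nonneg_left (inv_anti₀ (by positivity) ?_) (by positivity)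
    exact mul_le_mul_of_nonneg_left (le_mul_of_one_le_right hx0.le ht.1) (by positivity)

/-- After Fubini the weight `‖x‖^{-(d-1)}` cancels the polar Jacobian, and for fixed `z` the
admissible radii `‖x‖` lie in an interval of length `4`. -/
theorem lintegral_far_kernel_le {E : Type*} [NormedAddCommGroup E] [InnerProductSpace ℝ E]
    [MeasurableSpace E] [BorelSpace E] [FiniteDimensional ℝ E] [Nontrivial E]
    {H : E → ℝ≥0∞} (hH : Measurable H) :
    ∫⁻ x in {x : E | 4 ≤ ‖x‖}, ENNReal.ofReal (‖x‖ ^ (Module.finrank ℝ E - 1))⁻¹ *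
      ∫⁻ z in {z | |‖z‖ - ‖x‖| ≤ 2}, H z ≤
    ((volume : Measure E).toSphere Set.univ * 4) * ∫⁻ z, H z := by
  set d := Module.finrank ℝ E
  have hS : ∀ x : E, MeasurableSet {z : E | |‖z‖ - ‖x‖| ≤ 2} := fun x =>
    measurableSet_le (by fun_prop) measurable_const
  have hset : MeasurableSet {q : E × E | |‖q.2‖ - ‖q.1‖| ≤ 2} :=
    measurableSet_le (by fun_prop) measurable_const
  have hind : Measurable ({q : E × E | |‖q.2‖ - ‖q.1‖| ≤ 2}.indicator (1 : E × E → ℝ≥0∞)) :=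
    measurable_one.indicator hset
  calc _ = ∫⁻ x in {x : E | 4 ≤ ‖x‖}, ∫⁻ z, ENNReal.ofReal (‖x‖ ^ (d - 1))⁻¹ *
        ({q : E × E | |‖q.2‖ - ‖q.1‖| ≤ 2}.indicator (1 : E × E → ℝ≥0∞) (x, z) * H z) := by
        refine lintegral_congr fun x => ?_
        rw [← lintegral_const_mul _ hH, ← lintegral_indicator (hS x)]
        refine lintegral_congr fun z => ?_
        by_cases hz : |‖z‖ - ‖x‖| ≤ 2 <;> simp [hz]
    _ = ∫⁻ z, ∫⁻ x in {x : E | 4 ≤ ‖x‖}, ENNReal.ofReal (‖x‖ ^ (d - 1))⁻¹ *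
        ({q : E × E | |‖q.2‖ - ‖q.1‖| ≤ 2}.indicator (1 : E × E → ℝ≥0∞) (x, z) * H z) :=
        lintegral_lintegral_swap (by fun_prop)
    _ ≤ ∫⁻ z, ((volume : Measure E).toSphere Set.univ * 4) * H z := by
        refine lintegral_mono fun z => ?_
        have hI : Measurable ((Set.Ici (4 : ℝ) ∩ {r | |‖z‖ - r| ≤ 2}).indicator
            fun r : ℝ => ENNReal.ofReal (r ^ (d - 1))⁻¹) :=
          Measurable.indicator (by fun_prop)
            (measurableSet_Ici.inter (measurableSet_le (by fun_prop) measurable_const))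
        simp_rw [← mul_assoc]
        rw [lintegral_mul_const _ (by fun_prop)]
        refine mul_le_mul_left ?_ _
        have h4 : MeasurableSet {x : E | 4 ≤ ‖x‖} :=
          measurableSet_le measurable_const measurable_norm
        rw [← lintegral_indicator h4]
        have h1 := lintegral_comp_norm (volume : Measure E) hI
        refine le_trans (le_of_eq ?_) (h1.le.trans (mul_le_mul_right ?_ _))
        · refine lintegral_congr fun x => ?_
          by_cases hx : 4 ≤ ‖x‖ <;> by_cases hz : |‖z‖ - ‖x‖| ≤ 2 <;>
            simp [hx, hz]
        · calc _ ≤ ∫⁻ r in Set.Ioi (0 : ℝ), (Set.Icc (‖z‖ - 2) (‖z‖ + 2)).indicator 1 r := by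
                refine setLIntegral_mono (measurable_one.indicator measurableSet_Icc)
                  fun r hr => ?_
                have hr0 : 0 < r := hr
                by_cases hz : r ∈ Set.Ici (4 : ℝ) ∩ {r | |‖z‖ - r| ≤ 2}
                · rw [Set.indicator_of_mem hz, Set.indicator_of_mem,
                    ← ENNReal.ofReal_mul (by positivity)]
                  · simp [d, (pow_pos hr0 (d - 1)).ne']
                  · have := abs_le.1 (show |‖z‖ - r| ≤ 2 from hz.2)
                    constructor <;> linarith
                · rw [Set.indicator_of_notMem hz, mul_zero]
                  exact zero_le
            _ ≤ ∫⁻ r : ℝ, (Set.Icc (‖z‖ - 2) (‖z‖ + 2)).indicator 1 r :=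
                setLIntegral_le_lintegral _ _
            _ ≤ 4 := by
                rw [lintegral_indicator_one measurableSet_Icc, Real.volume_Icc]
                rw [show ‖z‖ + 2 - (‖z‖ - 2) = 4 by ring]
                simp
    _ = _ := lintegral_const_mul _ hH

theorem measurable_setLIntegral_annulus {E : Type*} [NormedAddCommGroup E] [MeasurableSpace E]
    [OpensMeasurableSpace E] {μ : Measure E} [SFinite μ] (a : ℝ) {H : E → ℝ≥0∞}
    (hH : Measurable H) : Measurable fun x : E => ∫⁻ z in {z | |‖z‖ - ‖x‖| ≤ a}, H z ∂μ := by
  have hset : MeasurableSet {q : E × E | |‖q.2‖ - ‖q.1‖| ≤ a} :=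
    measurableSet_le (((measurable_norm.comp measurable_snd).sub
      (measurable_norm.comp measurable_fst)).norm) measurable_const
  have h1 := ((hH.comp measurable_snd).indicator hset).lintegral_prod_right' (ν := μ)
  convert h1 using 2 with x
  exact (lintegral_indicator (measurableSet_le ((measurable_norm.sub_const _).norm)
    measurable_const) _).symm

theorem radialMaximal_le_of_le {d : ℕ} (hd : 2 ≤ d) {h : ℝ → ℝ≥0∞} (hh : Measurable h)
    (a : ℝ≥0∞) (x : EuclideanSpace ℝ (Fin d)) :
    radialMaximal h x ≤ radialMaximal ({r | a < h r}.indicator h) x + a := by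
  have := isProbabilityMeasure_sphereMeasure hd
  refine iSup₂_le fun t ht => ?_
  have hm : Measurable ({r | a < h r}.indicator h) :=
    hh.indicator (measurableSet_lt measurable_const hh)
  calc _ ≤ ∫⁻ y, ({r | a < h r}.indicator h ‖x - t • (y : EuclideanSpace ℝ (Fin d))‖ + a)
        ∂(sphereMeasure d) := by
        refine lintegral_mono fun y => ?_
        by_cases hy : a < h ‖x - t • (y : EuclideanSpace ℝ (Fin d))‖
        · rw [Set.indicator_of_mem (show _ ∈ {r | a < h r} from hy)]
          exact le_self_add
        · exact (not_lt.1 hy).trans le_add_self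
    _ = (∫⁻ y, {r | a < h r}.indicator h ‖x - t • (y : EuclideanSpace ℝ (Fin d))‖
        ∂(sphereMeasure d)) + a := by
        rw [lintegral_add_right _ measurable_const]
        simp
    _ ≤ _ := by
        refine add_le_add_left ?_ _
        exact le_iSup₂ (f := fun (t : ℝ) (_ : t ∈ Set.Icc (1 : ℝ) 2) =>
          ∫⁻ y, {r | a < h r}.indicator h ‖x - t • (y : EuclideanSpace ℝ (Fin d))‖
            ∂(sphereMeasure d)) t ht

theorem volume_norm_le {d : ℕ} (hd : 2 ≤ d) {r : ℝ≥0∞} (hr : r ≠ ∞) :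
    volume {x : EuclideanSpace ℝ (Fin d) | ENNReal.ofReal ‖x‖ ≤ r} =
      r ^ (d : ℝ) * volume (Metric.ball (0 : EuclideanSpace ℝ (Fin d)) 1) := by
  have := nontrivial_euclidean hd
  have h1 : {x : EuclideanSpace ℝ (Fin d) | ENNReal.ofReal ‖x‖ ≤ r} =
      Metric.closedBall 0 r.toReal := by
    ext x
    simp only [Set.mem_ofPred_eq, mem_closedBall_zero_iff]
    exact ENNReal.ofReal_le_iff_le_toReal hr
  rw [h1, Measure.addHaar_closedBall _ _ ENNReal.toReal_nonneg,
    ENNReal.ofReal_pow ENNReal.toReal_nonneg, ENNReal.ofReal_toReal hr]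
  simp

/-- With `A = l^{-p} ‖h‖_p^p`, the near part of the level set lies in a ball of radius `min (B^p A)
4`, of measure `O(A^d)` and bounded, hence `O(A^k)` for `k ≤ d`. The far part has measure `O(A)` and
is empty unless `A` is bounded below, hence is `O(A^k)` for `k ≥ 1`. -/
theorem radialMaximal_weak {d : ℕ} (hd : 2 ≤ d) {p : ℝ} (hp : d < ((d : ℝ) - 1) * p) {k : ℝ}
    (hk : 1 ≤ k) (hkd : k ≤ d) :
    ∃ K : ℝ≥0∞, K ≠ ∞ ∧ ∀ h : ℝ → ℝ≥0∞, Measurable h → ∀ l : ℝ, 0 < l →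
      volume {x : EuclideanSpace ℝ (Fin d) | ENNReal.ofReal l < radialMaximal h x} ≤
        K * (ENNReal.ofReal (l ^ (-p)) * ∫⁻ z : EuclideanSpace ℝ (Fin d), h ‖z‖ ^ p) ^ k := by
  have := nontrivial_euclidean hd
  have hd' : (2 : ℝ) ≤ d := by exact_mod_cast hd
  have hp0 : 0 < p := by nlinarith
  obtain ⟨B, hB, Hn⟩ := radialMaximal_le_near hd hp
  obtain ⟨B', hB', Hf⟩ := radialMaximal_le_far hd hp
  set V := volume (Metric.ball (0 : EuclideanSpace ℝ (Fin d)) 1)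
  have hV : V ≠ ∞ := measure_ball_lt_top.ne
  set c := (volume : Measure (EuclideanSpace ℝ (Fin d))).toSphere Set.univ
  have hc : c ≠ ∞ := measure_ne_top _ _
  set D := B' ^ p * (c * 4) + B' ^ p * ENNReal.ofReal (4 ^ (d - 1))⁻¹
  have hBp : B ^ p ≠ ∞ := ENNReal.rpow_ne_top_of_nonneg hp0.le hB
  have hBp' : B' ^ p ≠ ∞ := ENNReal.rpow_ne_top_of_nonneg hp0.le hB'
  have hD : D ≠ ∞ := by finiteness
  refine ⟨4 ^ (d : ℝ) * V * (B ^ p) ^ k + D ^ k, ?_, fun h hh l hl => ?_⟩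
  · have h1 : (B ^ p) ^ k ≠ ∞ := ENNReal.rpow_ne_top_of_nonneg (by linarith) hBp
    have h2 : D ^ k ≠ ∞ := ENNReal.rpow_ne_top_of_nonneg (by linarith) hD
    have h3 : (4 : ℝ≥0∞) ^ (d : ℝ) ≠ ∞ := ENNReal.rpow_ne_top_of_nonneg (by linarith) (by simp)
    finiteness
  set I := ∫⁻ z : EuclideanSpace ℝ (Fin d), h ‖z‖ ^ p
  set A := ENNReal.ofReal (l ^ (-p)) * I
  have hl0 : ENNReal.ofReal (l ^ p) ≠ 0 := (ENNReal.ofReal_pos.2 (by positivity)).ne'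
  have hlinv : ENNReal.ofReal (l ^ (-p)) = (ENNReal.ofReal (l ^ p))⁻¹ := by
    rw [Real.rpow_neg hl.le, ENNReal.ofReal_inv_of_pos (by positivity)]
  have hroot : ∀ b a : ℝ≥0∞, ENNReal.ofReal l < b * a ^ (1 / p) →
      1 ≤ b ^ p * (ENNReal.ofReal (l ^ (-p)) * a) := by
    intro b a hba
    have h1 := ENNReal.rpow_le_rpow hba.le hp0.le
    rw [ENNReal.mul_rpow_of_nonneg _ _ hp0.le, ← ENNReal.rpow_mul, one_div,
      inv_mul_cancel₀ hp0.ne', ENNReal.rpow_one, ENNReal.ofReal_rpow_of_pos hl] at h1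
    calc (1 : ℝ≥0∞) = (ENNReal.ofReal (l ^ p))⁻¹ * ENNReal.ofReal (l ^ p) :=
          (ENNReal.inv_mul_cancel hl0 (by finiteness)).symm
      _ ≤ (ENNReal.ofReal (l ^ p))⁻¹ * (b ^ p * a) := mul_le_mul_right h1 _
      _ = _ := by rw [hlinv]; ring
  set r := min (B ^ p * A) 4
  have hr : r ≠ ∞ := ((min_le_right _ _).trans_lt (by simp)).ne
  set F := {x : EuclideanSpace ℝ (Fin d) | 4 ≤ ‖x‖} ∩
    {x | ENNReal.ofReal l < radialMaximal h x}
  have hsub : {x : EuclideanSpace ℝ (Fin d) | ENNReal.ofReal l < radialMaximal h x} ⊆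
      {x | ENNReal.ofReal ‖x‖ ≤ r} ∪ F := by
    intro x hx
    rcases le_or_gt 4 ‖x‖ with h4 | h4
    · exact Or.inr ⟨h4, hx⟩
    left
    rcases eq_or_ne x 0 with rfl | hx0
    · simp
    refine le_min ?_ ((ENNReal.ofReal_le_ofReal h4.le).trans_eq (by simp))
    have hn : 0 < ‖x‖ := norm_pos_iff.2 hx0
    have h1 := hroot _ _ (lt_of_lt_of_le hx (Hn x hx0 h hh))
    calc ENNReal.ofReal ‖x‖ ≤ ENNReal.ofReal ‖x‖ *
          (B ^ p * (ENNReal.ofReal (l ^ (-p)) * (ENNReal.ofReal ‖x‖⁻¹ * I))) := by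
          simpa using mul_le_mul_right h1 (ENNReal.ofReal ‖x‖)
      _ = (ENNReal.ofReal ‖x‖ * ENNReal.ofReal ‖x‖⁻¹) * (B ^ p * A) := by ring
      _ = B ^ p * A := by
          rw [← ENNReal.ofReal_mul hn.le, mul_inv_cancel₀ hn.ne', ENNReal.ofReal_one, one_mul]
  have hnear : volume {x : EuclideanSpace ℝ (Fin d) | ENNReal.ofReal ‖x‖ ≤ r} ≤
      4 ^ (d : ℝ) * V * (B ^ p) ^ k * A ^ k := by
    rw [volume_norm_le hd hr]
    have h1 : r ≤ 4 * min (B ^ p * A) 1 := by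
      rcases le_total (B ^ p * A) 1 with h | h
      · rw [min_eq_left h]
        exact (min_le_left _ _).trans (le_mul_of_one_le_left' (by norm_num))
      · rw [min_eq_right h, mul_one]
        exact min_le_right _ _
    have h2 : min (B ^ p * A) 1 ^ (d : ℝ) ≤ (B ^ p * A) ^ k :=
      (ENNReal.rpow_le_rpow_of_exponent_ge (min_le_right _ _) hkd).trans
        (ENNReal.rpow_le_rpow (min_le_left _ _) (by linarith))
    calc r ^ (d : ℝ) * V ≤ (4 * min (B ^ p * A) 1) ^ (d : ℝ) * V :=
          mul_le_mul_left (ENNReal.rpow_le_rpow h1 (by linarith)) _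
      _ = 4 ^ (d : ℝ) * V * min (B ^ p * A) 1 ^ (d : ℝ) := by
          rw [ENNReal.mul_rpow_of_nonneg _ _ (by linarith)]
          ring
      _ ≤ 4 ^ (d : ℝ) * V * (B ^ p * A) ^ k := mul_le_mul_right h2 _
      _ = _ := by
          rw [ENNReal.mul_rpow_of_nonneg _ _ (by linarith)]
          ring
  have hfar : volume F ≤ D ^ k * A ^ k := by
    rcases F.eq_empty_or_nonempty with hF | ⟨x₀, hx₀⟩
    · simp [hF]
    -- A single far point of the level set already bounds `A` from below; `D` contains the second
    -- summand for this purpose, and then `D A ≤ (D A)^k`.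
    have hDA1 : 1 ≤ D * A := by
      have h1 := hroot _ _ (lt_of_lt_of_le hx₀.2 (Hf x₀ hx₀.1 h hh))
      have hx4 : 4 ≤ ‖x₀‖ := hx₀.1
      have h2 : ENNReal.ofReal (‖x₀‖ ^ (d - 1))⁻¹ ≤ ENNReal.ofReal (4 ^ (d - 1))⁻¹ :=
        ENNReal.ofReal_le_ofReal (inv_anti₀ (by positivity)
          (pow_le_pow_left₀ (by norm_num) hx4 _))
      calc 1 ≤ B' ^ p * (ENNReal.ofReal (l ^ (-p)) * (ENNReal.ofReal (4 ^ (d - 1))⁻¹ * I)) :=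
            h1.trans (mul_le_mul_right (mul_le_mul_right (mul_le_mul' h2
              (setLIntegral_le_lintegral _ _)) _) _)
        _ = B' ^ p * ENNReal.ofReal (4 ^ (d - 1))⁻¹ * A := by ring
        _ ≤ D * A := mul_le_mul_left le_add_self _
    have hFD : volume F ≤ D * A := by
      have hker := lintegral_far_kernel_le (E := EuclideanSpace ℝ (Fin d))
        (H := fun z => h ‖z‖ ^ p) (by fun_prop)
      simp only [finrank_euclideanSpace, Fintype.card_fin] at hker
      set f : EuclideanSpace ℝ (Fin d) → ℝ≥0∞ := fun x => B' ^ p * (ENNReal.ofReal (l ^ (-p)) *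
        (ENNReal.ofReal (‖x‖ ^ (d - 1))⁻¹ * ∫⁻ z : EuclideanSpace ℝ (Fin d) in
          {z | |‖z‖ - ‖x‖| ≤ 2}, h ‖z‖ ^ p))
      have hfm : Measurable f :=
        (((by fun_prop : Measurable fun x : EuclideanSpace ℝ (Fin d) =>
          ENNReal.ofReal (‖x‖ ^ (d - 1))⁻¹).mul (measurable_setLIntegral_annulus 2
            (H := fun z => h ‖z‖ ^ p) (by fun_prop))).const_mul _).const_mul _
      have hone : ∀ x ∈ F, 1 ≤ f x := fun x hx =>
        hroot _ _ (lt_of_lt_of_le hx.2 (Hf x hx.1 h hh))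
      have hF4 : F ⊆ {x | 1 ≤ f x} ∩ {x | 4 ≤ ‖x‖} := fun x hx => ⟨hone x hx, hx.1⟩
      have hm4 : MeasurableSet {x : EuclideanSpace ℝ (Fin d) | 4 ≤ ‖x‖} :=
        measurableSet_le measurable_const measurable_norm
      have hlp : ENNReal.ofReal (l ^ (-p)) ≠ ∞ := by finiteness
      calc volume F ≤ volume.restrict {x : EuclideanSpace ℝ (Fin d) | 4 ≤ ‖x‖} {x | 1 ≤ f x} := by
            rw [Measure.restrict_apply' hm4]
            exact measure_mono hF4
        _ ≤ ∫⁻ x in {x : EuclideanSpace ℝ (Fin d) | 4 ≤ ‖x‖}, f x := by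
            simpa using mul_meas_ge_le_lintegral₀ (μ := volume.restrict
              {x : EuclideanSpace ℝ (Fin d) | 4 ≤ ‖x‖}) hfm.aemeasurable 1
        _ = B' ^ p * (ENNReal.ofReal (l ^ (-p)) * _) := by
            rw [lintegral_const_mul' _ _ hBp', lintegral_const_mul' _ _ hlp]
        _ ≤ B' ^ p * (ENNReal.ofReal (l ^ (-p)) * (c * 4 * I)) :=
            mul_le_mul_right (mul_le_mul_right hker _) _
        _ = B' ^ p * (c * 4) * A := by ring
        _ ≤ D * A := mul_le_mul_left le_self_add _
    calc volume F ≤ (D * A) ^ (1 : ℝ) := by simpa using hFD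
      _ ≤ (D * A) ^ k := ENNReal.rpow_le_rpow_of_exponent_le hDA1 hk
      _ = _ := ENNReal.mul_rpow_of_nonneg _ _ (by linarith)
  calc _ ≤ _ := measure_mono hsub
    _ ≤ _ := measure_union_le _ _
    _ ≤ 4 ^ (d : ℝ) * V * (B ^ p) ^ k * A ^ k + D ^ k * A ^ k := add_le_add hnear hfar
    _ = _ := by ring

/-- The strong type estimate for the maximal function of radial functions. -/
theorem lintegral_rpow_le_of_le_radialMaximal {d : ℕ} (hd : 2 ≤ d) {p : ℝ}
    (hp : d < ((d : ℝ) - 1) * p) {k : ℝ} (hk : 1 ≤ k) (hkd : k ≤ d) :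
    ∃ C : ℝ≥0∞, C ≠ ∞ ∧ ∀ (G : EuclideanSpace ℝ (Fin d) → ℝ≥0∞) (h : ℝ → ℝ≥0∞),
      AEMeasurable G volume → Measurable h → (∀ᵐ x, G x ≠ ∞) →
      (∀ x, x ≠ 0 → G x ≤ radialMaximal h x) →
      ∫⁻ x, G x ^ (k * p) ≤ C * (∫⁻ z : EuclideanSpace ℝ (Fin d), h ‖z‖ ^ p) ^ k := by
  have hd' : (2 : ℝ) ≤ d := by exact_mod_cast hd
  have hdp : (d : ℝ) / (d - 1) < p := by
    rw [div_lt_iff₀ (by linarith)]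
    linarith
  -- The condition on `p` is open, so the weak type estimate is available at a smaller exponent on
  -- the same ray `q = k p`.
  obtain ⟨p₀, h0, hp₀⟩ := exists_between hdp
  have hd0 : (d : ℝ) < (d - 1) * p₀ := by
    rw [div_lt_iff₀ (by linarith)] at h0
    linarith
  have hp₀0 : 0 < p₀ := by nlinarith
  obtain ⟨K, hK, Hw⟩ := radialMaximal_weak hd hd0 hk hkd
  have hK' : K * ENNReal.ofReal (2 ^ p₀) ^ k ≠ ∞ := ENNReal.mul_ne_top hK
    (ENNReal.rpow_ne_top_of_nonneg (by linarith) (by finiteness))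
  obtain ⟨C, hC, H⟩ := lintegral_rpow_le_of_weak (volume : Measure (EuclideanSpace ℝ (Fin d)))
    (volume : Measure (EuclideanSpace ℝ (Fin d))) hp₀0 hp₀ hk hK'
  refine ⟨C, hC, fun G h hG hh hGt hGle => H G (fun z => h ‖z‖) hG (by fun_prop) hGt ?_⟩
  intro l hl
  set h₁ := {r | ENNReal.ofReal (l / 2) < h r}.indicator h
  have hh₁ : Measurable h₁ := hh.indicator (measurableSet_lt measurable_const hh)
  -- The part of `h` below height `l / 2` contributes at most `l / 2` to the maximal function. The
  -- origin, where nothing is assumed about `G`, is a null set.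
  have hae : {x | ENNReal.ofReal l < G x} ⊆
      {0} ∪ {x | ENNReal.ofReal (l / 2) < radialMaximal h₁ x} := by
    intro x hx
    rcases eq_or_ne x 0 with rfl | hx0
    · exact Or.inl rfl
    right
    have h1 := (hGle x hx0).trans (radialMaximal_le_of_le hd hh (ENNReal.ofReal (l / 2)) x)
    have h2 : ENNReal.ofReal (l / 2) + ENNReal.ofReal (l / 2) = ENNReal.ofReal l := by
      rw [← ENNReal.ofReal_add (by positivity) (by positivity), add_halves]
    by_contra hcon
    refine absurd (lt_of_lt_of_le hx h1) (not_lt.2 ?_)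
    rw [← h2]
    exact add_le_add_left (not_lt.1 hcon) _
  have h3 : ∫⁻ z : EuclideanSpace ℝ (Fin d), h₁ ‖z‖ ^ p₀ =
      ∫⁻ z : EuclideanSpace ℝ (Fin d) in {z | ENNReal.ofReal (l / 2) < h ‖z‖}, h ‖z‖ ^ p₀ := by
    rw [← lintegral_indicator (measurableSet_lt measurable_const (by fun_prop))]
    refine lintegral_congr fun z => ?_
    by_cases hz : ENNReal.ofReal (l / 2) < h ‖z‖ <;> simp [h₁, hz, hp₀0]
  have := nontrivial_euclidean hd
  calc _ ≤ _ := measure_mono hae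
    _ ≤ _ := measure_union_le _ _
    _ ≤ K * (ENNReal.ofReal ((l / 2) ^ (-p₀)) *
        ∫⁻ z : EuclideanSpace ℝ (Fin d), h₁ ‖z‖ ^ p₀) ^ k := by
      rw [measure_singleton, zero_add]
      exact Hw h₁ hh₁ (l / 2) (by positivity)
    _ = _ := by
      rw [h3, Real.div_rpow hl.le (by norm_num), Real.rpow_neg (by norm_num : (0 : ℝ) ≤ 2),
        div_inv_eq_mul, mul_comm (l ^ (-p₀)), ENNReal.ofReal_mul (by positivity), mul_assoc,
        ENNReal.mul_rpow_of_nonneg _ _ (by linarith : 0 ≤ k), mul_assoc]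

/-! ### Borel profiles, measurability of the maximal function and convergence of the means. -/

/-- By polar coordinates, the null set where `f` differs from its measurable version meets the ray
in almost every direction `y` in a null set `N` of radii. Fix one such `y` and read the profile off
that ray; radiality transports it to all directions. -/
theorem exists_measurable_radial_representative {d : ℕ} (hd : 2 ≤ d)
    {f : EuclideanSpace ℝ (Fin d) → ℂ} (hf : IsRadial f) (hm : AEStronglyMeasurable f volume) :
    ∃ (g : ℝ → ℂ) (N : Set ℝ), Measurable g ∧ MeasurableSet N ∧
      volume {x : EuclideanSpace ℝ (Fin d) | ‖x‖ ∈ N} = 0 ∧ ∀ x, ‖x‖ ∉ N → f x = g ‖x‖ := by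
  have := nontrivial_euclidean hd
  obtain ⟨Z, hZ1, hZm, hZ0⟩ := exists_measurable_superset_of_null (ae_iff.1 hm.ae_eq_mk)
  have h1 := lintegral_eq_lintegral_sphere_lintegral
    (volume : Measure (EuclideanSpace ℝ (Fin d)))
    (F := Z.indicator 1) (measurable_one.indicator hZm)
  have hmeas : Measurable fun y : Metric.sphere (0 : EuclideanSpace ℝ (Fin d)) 1 =>
      ∫⁻ r in Set.Ioi (0 : ℝ), ENNReal.ofReal
        (r ^ (Module.finrank ℝ (EuclideanSpace ℝ (Fin d)) - 1)) *
        Z.indicator 1 (r • (y : EuclideanSpace ℝ (Fin d))) := by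
    refine Measurable.lintegral_prod_right' (f := fun q :
      Metric.sphere (0 : EuclideanSpace ℝ (Fin d)) 1 × ℝ => ENNReal.ofReal
        (q.2 ^ (Module.finrank ℝ (EuclideanSpace ℝ (Fin d)) - 1)) *
        Z.indicator (1 : EuclideanSpace ℝ (Fin d) → ℝ≥0∞)
          (q.2 • (q.1 : EuclideanSpace ℝ (Fin d)))) ?_
    exact (by fun_prop : Measurable _).mul
      ((measurable_one.indicator hZm).comp (by fun_prop))
  rw [lintegral_indicator_one hZm, hZ0, eq_comm, lintegral_eq_zero_iff hmeas] at h1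
  have : NeZero (volume : Measure (EuclideanSpace ℝ (Fin d))).toSphere :=
    ⟨Measure.toSphere_ne_zero _⟩
  obtain ⟨y, hy⟩ := h1.exists
  have hy1 : ‖(y : EuclideanSpace ℝ (Fin d))‖ = 1 := by simp
  have hNm : MeasurableSet {r : ℝ | r • (y : EuclideanSpace ℝ (Fin d)) ∈ Z} :=
    (by fun_prop : Measurable fun r : ℝ => r • (y : EuclideanSpace ℝ (Fin d))) hZm
  refine ⟨fun r => hm.mk f (r • (y : EuclideanSpace ℝ (Fin d))),
    {r | r • (y : EuclideanSpace ℝ (Fin d)) ∈ Z},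
    hm.stronglyMeasurable_mk.measurable.comp (by fun_prop), hNm, ?_, ?_⟩
  · have h2 := lintegral_comp_norm (volume : Measure (EuclideanSpace ℝ (Fin d)))
      (h := {r : ℝ | r • (y : EuclideanSpace ℝ (Fin d)) ∈ Z}.indicator 1)
      (measurable_one.indicator hNm)
    rw [show (fun x : EuclideanSpace ℝ (Fin d) =>
      {r : ℝ | r • (y : EuclideanSpace ℝ (Fin d)) ∈ Z}.indicator (1 : ℝ → ℝ≥0∞) ‖x‖) =
      {x | ‖x‖ ∈ {r : ℝ | r • (y : EuclideanSpace ℝ (Fin d)) ∈ Z}}.indicator 1 from rfl,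
      lintegral_indicator_one (show MeasurableSet {x : EuclideanSpace ℝ (Fin d) |
        ‖x‖ ∈ {r : ℝ | r • (y : EuclideanSpace ℝ (Fin d)) ∈ Z}} from measurable_norm hNm)] at h2
    rw [h2]
    refine mul_eq_zero_of_right _ ?_
    exact hy
  · intro x hx
    rw [hf x (‖x‖ • (y : EuclideanSpace ℝ (Fin d))) (by simp [norm_smul])]
    by_contra hne
    exact hx (hZ1 hne)

/-- The near bound applied to the indicator of `N`, whose `L^p` norm vanishes. The origin must be
excluded, since spheres about it have a single radius. Changing a profile on `N` thus changes no
mean off the origin. -/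
theorem ae_sphere_norm_sub_notMem {d : ℕ} (hd : 2 ≤ d) {N : Set ℝ} (hN : MeasurableSet N)
    (hN0 : volume {x : EuclideanSpace ℝ (Fin d) | ‖x‖ ∈ N} = 0)
    {x : EuclideanSpace ℝ (Fin d)} (hx : x ≠ 0) {t : ℝ} (ht : t ∈ Set.Icc (1 : ℝ) 2) :
    ∀ᵐ y : Metric.sphere (0 : EuclideanSpace ℝ (Fin d)) 1 ∂(sphereMeasure d), ‖x - t • (y : EuclideanSpace ℝ (Fin d))‖ ∉ N := by
  have hd' : (2 : ℝ) ≤ d := by exact_mod_cast hd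
  -- Any exponent above `d / (d - 1) ≤ 2` would do.
  obtain ⟨B, hB, H⟩ := radialMaximal_le_near hd (p := 3) (by linarith)
  have h1 := H x hx (N.indicator 1) (measurable_one.indicator hN)
  have h2 : ∫⁻ z : EuclideanSpace ℝ (Fin d), N.indicator (1 : ℝ → ℝ≥0∞) ‖z‖ ^ (3 : ℝ) = 0 := by
    rw [← hN0, ← lintegral_indicator_one
      (show MeasurableSet {x : EuclideanSpace ℝ (Fin d) | ‖x‖ ∈ N} from measurable_norm hN)]
    refine lintegral_congr fun z => ?_
    by_cases hz : ‖z‖ ∈ N <;> simp [hz]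
  rw [h2, mul_zero, ENNReal.zero_rpow_of_pos (by norm_num), mul_zero] at h1
  have h3 := (le_iSup₂ (f := fun (t : ℝ) (_ : t ∈ Set.Icc (1 : ℝ) 2) =>
    ∫⁻ y, N.indicator (1 : ℝ → ℝ≥0∞) ‖x - t • (y : EuclideanSpace ℝ (Fin d))‖
      ∂(sphereMeasure d)) t ht).trans h1
  have hmy : Measurable fun y : Metric.sphere (0 : EuclideanSpace ℝ (Fin d)) 1 =>
      ‖x - t • (y : EuclideanSpace ℝ (Fin d))‖ := by fun_prop
  have hmi : Measurable fun y : Metric.sphere (0 : EuclideanSpace ℝ (Fin d)) 1 =>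
      N.indicator (1 : ℝ → ℝ≥0∞) ‖x - t • (y : EuclideanSpace ℝ (Fin d))‖ :=
    (measurable_one.indicator hN).comp hmy
  rw [nonpos_iff_eq_zero, lintegral_eq_zero_iff hmi] at h3
  filter_upwards [h3] with y hy hyN
  simp [hyN] at hy

theorem onSphere_ae_eq {d : ℕ} (hd : 2 ≤ d) {f : EuclideanSpace ℝ (Fin d) → ℂ} {g : ℝ → ℂ}
    {N : Set ℝ} (hN : MeasurableSet N)
    (hN0 : volume {x : EuclideanSpace ℝ (Fin d) | ‖x‖ ∈ N} = 0)
    (hfg : ∀ x, ‖x‖ ∉ N → f x = g ‖x‖)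
    {x : EuclideanSpace ℝ (Fin d)} (hx : x ≠ 0) {t : ℝ} (ht : t ∈ Set.Icc (1 : ℝ) 2) :
    onSphere f t x =ᵐ[sphereMeasure d] onSphere (fun z => g ‖z‖) t x := by
  filter_upwards [ae_sphere_norm_sub_notMem hd hN hN0 hx ht] with y hy
  exact hfg _ hy

theorem sphericalMaximal_eq {d : ℕ} (hd : 2 ≤ d) {f : EuclideanSpace ℝ (Fin d) → ℂ} {g : ℝ → ℂ}
    {N : Set ℝ} (hN : MeasurableSet N)
    (hN0 : volume {x : EuclideanSpace ℝ (Fin d) | ‖x‖ ∈ N} = 0)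
    (hfg : ∀ x, ‖x‖ ∉ N → f x = g ‖x‖)
    {x : EuclideanSpace ℝ (Fin d)} (hx : x ≠ 0) :
    sphericalMaximal (Set.Icc 1 2) f x = sphericalMaximal (Set.Icc 1 2) (fun z => g ‖z‖) x := by
  refine iSup_congr fun t => iSup_congr fun ht => ?_
  rw [sphericalMean, sphericalMean, integral_congr_ae (onSphere_ae_eq hd hN hN0 hfg hx ht)]

theorem sphericalMaximal_le_radialMaximal {d : ℕ} (g : ℝ → ℂ) (x : EuclideanSpace ℝ (Fin d)) :
    sphericalMaximal (Set.Icc 1 2) (fun z => g ‖z‖) x ≤ radialMaximal (fun r => ‖g r‖ₑ) x :=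
  iSup₂_mono fun _ _ => enorm_integral_le_lintegral_enorm _

theorem measurable_onSphere {d : ℕ} {g : ℝ → ℂ} (hg : Measurable g) (t : ℝ)
    (x : EuclideanSpace ℝ (Fin d)) : Measurable (onSphere (fun z => g ‖z‖) t x) :=
  hg.comp (by fun_prop : Measurable fun y : Metric.sphere (0 : EuclideanSpace ℝ (Fin d)) 1 =>
      ‖x - t • (y : EuclideanSpace ℝ (Fin d))‖)

theorem integrable_onSphere {d : ℕ} {g : ℝ → ℂ} (hg : Measurable g)
    {x : EuclideanSpace ℝ (Fin d)} (h : radialMaximal (fun r => ‖g r‖ₑ) x ≠ ∞) {t : ℝ}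
    (ht : t ∈ Set.Icc (1 : ℝ) 2) : Integrable (onSphere (fun z => g ‖z‖) t x) (sphereMeasure d) :=
  ⟨(measurable_onSphere hg t x).aestronglyMeasurable,
    (le_iSup₂ (f := fun (t : ℝ) (_ : t ∈ Set.Icc (1 : ℝ) 2) =>
      ∫⁻ y, ‖g ‖x - t • (y : EuclideanSpace ℝ (Fin d))‖‖ₑ ∂(sphereMeasure d)) t ht).trans_lt
      h.lt_top⟩

/-- The finiteness hypotheses make all means genuine integrals: the Bochner integral of a
non-integrable function is zero, and additivity could fail. -/
theorem sphericalMaximal_le_add {d : ℕ} {g₁ g₂ : ℝ → ℂ} (hg₁ : Measurable g₁)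
    (hg₂ : Measurable g₂) {x : EuclideanSpace ℝ (Fin d)}
    (h₁ : radialMaximal (fun r => ‖g₁ r‖ₑ) x ≠ ∞) (h₂ : radialMaximal (fun r => ‖g₂ r‖ₑ) x ≠ ∞) :
    sphericalMaximal (Set.Icc 1 2) (fun z => g₁ ‖z‖) x ≤
      sphericalMaximal (Set.Icc 1 2) (fun z => g₂ ‖z‖) x +
        radialMaximal (fun r => ‖g₁ r - g₂ r‖ₑ) x := by
  refine iSup₂_le fun t ht => ?_
  have hi₁ := integrable_onSphere hg₁ h₁ ht
  have hi₂ := integrable_onSphere hg₂ h₂ ht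
  have h3 : sphericalMean (fun z => g₁ ‖z‖) t x = sphericalMean (fun z => g₂ ‖z‖) t x +
      ∫ y, (onSphere (fun z => g₁ ‖z‖) t x y - onSphere (fun z => g₂ ‖z‖) t x y)
        ∂(sphereMeasure d) := by
    rw [integral_sub hi₁ hi₂]
    simp [sphericalMean]
  rw [h3]
  refine (enorm_add_le _ _).trans (add_le_add ?_ ?_)
  · exact le_iSup₂ (f := fun (t : ℝ) (_ : t ∈ Set.Icc (1 : ℝ) 2) =>
      ‖sphericalMean (fun z => g₂ ‖z‖) t x‖ₑ) t ht
  · exact (enorm_integral_le_lintegral_enorm _).trans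
      (le_iSup₂ (f := fun (t : ℝ) (_ : t ∈ Set.Icc (1 : ℝ) 2) =>
      ∫⁻ y, ‖g₁ ‖x - t • (y : EuclideanSpace ℝ (Fin d))‖ -
        g₂ ‖x - t • (y : EuclideanSpace ℝ (Fin d))‖‖ₑ ∂(sphereMeasure d)) t ht)

/-- A supremum of any family of continuous functions is lower semicontinuous, so the uncountable set
of radii does no harm here. -/
theorem measurable_sphericalMaximal_of_continuous {d : ℕ} (hd : 2 ≤ d) (E : Set ℝ)
    {f : EuclideanSpace ℝ (Fin d) → ℂ} (hf : Continuous f) :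
    Measurable (sphericalMaximal E f) := by
  have := isProbabilityMeasure_sphereMeasure hd
  refine LowerSemicontinuous.measurable ?_
  refine lowerSemicontinuous_iSup fun t => lowerSemicontinuous_iSup fun _ => ?_
  refine Continuous.lowerSemicontinuous (Continuous.enorm ?_)
  have h1 := continuous_parametric_integral_of_continuous (μ := sphereMeasure d)
    (f := fun (x : EuclideanSpace ℝ (Fin d))
      (y : Metric.sphere (0 : EuclideanSpace ℝ (Fin d)) 1) => onSphere f t x y)
    (by unfold onSphere Function.uncurry; fun_prop) isCompact_univ
  rwa [Measure.restrict_univ] at h1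

theorem radialMaximal_ne_top {d : ℕ} (hd : 2 ≤ d) {p : ℝ} (hp : d < ((d : ℝ) - 1) * p)
    {h : ℝ → ℝ≥0∞} (hh : Measurable h)
    (hfin : ∫⁻ z : EuclideanSpace ℝ (Fin d), h ‖z‖ ^ p ≠ ∞)
    {x : EuclideanSpace ℝ (Fin d)} (hx : x ≠ 0) : radialMaximal h x ≠ ∞ := by
  have hd' : (2 : ℝ) ≤ d := by exact_mod_cast hd
  have hp0 : 0 < p := by nlinarith
  obtain ⟨B, hB, H⟩ := radialMaximal_le_near hd hp
  refine ne_top_of_le_ne_top (ENNReal.mul_ne_top hB (ENNReal.rpow_ne_top_of_nonneg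
    (by positivity) (ENNReal.mul_ne_top (by finiteness) hfin))) (H x hx h hh)

/-- Allows profiles to be approximated by continuous compactly supported ones in `L^p` of the law of
the norm, which keeps the approximants radial. -/
theorem isLocallyFiniteMeasure_map_norm {d : ℕ} : IsLocallyFiniteMeasure
    (Measure.map (fun x : EuclideanSpace ℝ (Fin d) => ‖x‖) volume) := by
  refine ⟨fun r => ⟨Metric.ball r 1, Metric.ball_mem_nhds _ one_pos, ?_⟩⟩
  rw [Measure.map_apply measurable_norm Metric.isOpen_ball.measurableSet]
  refine (measure_mono fun x hx => ?_).trans_lt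
    (measure_closedBall_lt_top (x := (0 : EuclideanSpace ℝ (Fin d))) (r := r + 1))
  have h1 : dist ‖x‖ r < 1 := hx
  rw [Real.dist_eq, abs_lt] at h1
  rw [mem_closedBall_zero_iff]
  linarith

/-- Continuous profiles `u n` converge to `g` in `L^p`. For fixed `x ≠ 0` the near bound turns this
into convergence of the maximal function of `|g - u n|` at `x` to zero, and sublinearity squeezes
the maximal functions of `u n` to that of `g`. -/
theorem aemeasurable_sphericalMaximal_of_memLp {d : ℕ} (hd : 2 ≤ d) {p : ℝ}
    (hp : d < ((d : ℝ) - 1) * p) {g : ℝ → ℂ} (hg : Measurable g)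
    (hgp : MemLp (fun x : EuclideanSpace ℝ (Fin d) => g ‖x‖) (ENNReal.ofReal p) volume) :
    AEMeasurable (sphericalMaximal (d := d) (Set.Icc 1 2) fun z => g ‖z‖) volume := by
  have hd' : (2 : ℝ) ≤ d := by exact_mod_cast hd
  have := nontrivial_euclidean hd
  have hp0 : 0 < p := by nlinarith
  have hpe : ENNReal.ofReal p ≠ 0 := (ENNReal.ofReal_pos.2 hp0).ne'
  have hnorm : ∀ g : ℝ → ℂ, eLpNorm (fun x : EuclideanSpace ℝ (Fin d) => g ‖x‖)
      (ENNReal.ofReal p) volume =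
        (∫⁻ x : EuclideanSpace ℝ (Fin d), ‖g ‖x‖‖ₑ ^ p) ^ (1 / p) := fun g => by
    rw [eLpNorm_eq_lintegral_rpow_enorm_toReal hpe (by finiteness), ENNReal.toReal_ofReal hp0.le]
  obtain ⟨B, hB, H⟩ := radialMaximal_le_near hd hp
  set ν := Measure.map (fun x : EuclideanSpace ℝ (Fin d) => ‖x‖) volume
  have : IsLocallyFiniteMeasure ν := isLocallyFiniteMeasure_map_norm
  have hgν : MemLp g (ENNReal.ofReal p) ν :=
    (memLp_map_measure_iff hg.aestronglyMeasurable measurable_norm.aemeasurable).2 hgp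
  have happrox : ∀ n : ℕ, ∃ u : ℝ → ℂ, Continuous u ∧
      MemLp (fun x : EuclideanSpace ℝ (Fin d) => u ‖x‖) (ENNReal.ofReal p) volume ∧
      eLpNorm (fun x : EuclideanSpace ℝ (Fin d) => g ‖x‖ - u ‖x‖) (ENNReal.ofReal p) volume ≤
        ((n : ℝ≥0∞) + 1)⁻¹ := by
    intro n
    obtain ⟨u, -, h1, h2, h3⟩ := hgν.exists_hasCompactSupport_eLpNorm_sub_le
      (ENNReal.ofReal_ne_top) (ε := ((n : ℝ≥0∞) + 1)⁻¹) (by simp)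
    refine ⟨u, h2, (memLp_map_measure_iff h2.aestronglyMeasurable
      measurable_norm.aemeasurable).1 h3, ?_⟩
    rwa [eLpNorm_map_measure (hg.aestronglyMeasurable.sub h2.aestronglyMeasurable)
      measurable_norm.aemeasurable] at h1
  choose u huc hup hun using happrox
  have hfin : ∀ v : ℝ → ℂ, Measurable v →
      MemLp (fun x : EuclideanSpace ℝ (Fin d) => v ‖x‖) (ENNReal.ofReal p) volume →
      ∀ x : EuclideanSpace ℝ (Fin d), x ≠ 0 → radialMaximal (fun r => ‖v r‖ₑ) x ≠ ∞ := by
    intro v hv hvp x hx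
    refine radialMaximal_ne_top hd hp (by fun_prop) ?_ hx
    have h1 := hvp.2
    rw [hnorm] at h1
    exact fun h => by simp [h, hp0] at h1
  refine aemeasurable_of_tendsto_metrizable_ae Filter.atTop
    (f := fun n => sphericalMaximal (d := d) (Set.Icc 1 2) fun z => u n ‖z‖)
    (fun n => (measurable_sphericalMaximal_of_continuous hd _
      ((huc n).comp continuous_norm)).aemeasurable) ?_
  have hae : ∀ᵐ x : EuclideanSpace ℝ (Fin d), x ≠ 0 := by
    simp [ae_iff]
  filter_upwards [hae] with x hx
  set ε : ℕ → ℝ≥0∞ := fun n => radialMaximal (fun r => ‖g r - u n r‖ₑ) x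
  set c : ℝ≥0∞ := B * ENNReal.ofReal ‖x‖⁻¹ ^ (1 / p)
  have hc : c ≠ ∞ := ENNReal.mul_ne_top hB
    (ENNReal.rpow_ne_top_of_nonneg (by positivity) (by finiteness))
  have hε : Filter.Tendsto ε Filter.atTop (nhds 0) := by
    have h1 : ∀ n, ε n ≤ c * ((n : ℝ≥0∞) + 1)⁻¹ := by
      intro n
      have hum := (huc n).measurable
      refine (H x hx _ (by fun_prop)).trans ?_
      rw [ENNReal.mul_rpow_of_nonneg _ _ (by positivity), ← mul_assoc]
      refine mul_le_mul_right ?_ _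
      rw [← hnorm (fun r => g r - u n r)]
      exact hun n
    have h2 : Filter.Tendsto (fun n : ℕ => c * ((n : ℝ≥0∞) + 1)⁻¹) Filter.atTop (nhds 0) := by
      have h3 : Filter.Tendsto (fun n : ℕ => ((n : ℝ≥0∞) + 1)⁻¹) Filter.atTop (nhds 0) := by
        have := (Filter.tendsto_add_atTop_iff_nat 1).2 ENNReal.tendsto_inv_nat_nhds_zero
        simpa using this
      simpa using ENNReal.Tendsto.const_mul h3 (Or.inr hc)
    exact tendsto_of_tendsto_of_tendsto_of_le_of_le tendsto_const_nhds h2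
      (fun n => zero_le) h1
  set M := sphericalMaximal (d := d) (Set.Icc 1 2) (fun z => g ‖z‖) x
  have hle1 : ∀ n, M - ε n ≤ sphericalMaximal (d := d) (Set.Icc 1 2) (fun z => u n ‖z‖) x := by
    intro n
    rw [tsub_le_iff_right]
    exact sphericalMaximal_le_add hg (huc n).measurable (hfin g hg hgp x hx)
      (hfin _ (huc n).measurable (hup n) x hx)
  have hle2 : ∀ n, sphericalMaximal (d := d) (Set.Icc 1 2) (fun z => u n ‖z‖) x ≤ M + ε n := by
    intro n
    refine (sphericalMaximal_le_add (huc n).measurable hg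
      (hfin _ (huc n).measurable (hup n) x hx) (hfin g hg hgp x hx)).trans (le_of_eq ?_)
    congr 2
    funext r
    exact enorm_sub_rev _ _
  refine tendsto_of_tendsto_of_tendsto_of_le_of_le ?_ ?_ hle1 hle2
  · simpa using ENNReal.Tendsto.sub (tendsto_const_nhds (x := M)) hε (Or.inr ENNReal.zero_ne_top)
  · simpa using (tendsto_const_nhds (x := M)).add hε

theorem radialMaximal_le_of_forall_le {d : ℕ} (hd : 2 ≤ d) {h : ℝ → ℝ≥0∞} {M : ℝ≥0∞}
    (hM : ∀ r, h r ≤ M) (x : EuclideanSpace ℝ (Fin d)) : radialMaximal h x ≤ M := by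
  have := isProbabilityMeasure_sphereMeasure hd
  exact iSup₂_le fun t ht => (lintegral_mono fun y => hM _).trans (by simp)

/-- Continuous functions are not dense in `L^∞`, so the case `p = ∞` is reduced to finite `p` by
restricting the profile to balls. -/
theorem aemeasurable_sphericalMaximal_of_bounded {d : ℕ} (hd : 2 ≤ d) {g : ℝ → ℂ}
    (hg : Measurable g) {M : ℝ≥0∞} (hMt : M ≠ ∞) (hM : ∀ r, ‖g r‖ₑ ≤ M) :
    AEMeasurable (sphericalMaximal (d := d) (Set.Icc 1 2) fun z => g ‖z‖) volume := by
  have hd' : (2 : ℝ) ≤ d := by exact_mod_cast hd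
  refine aemeasurable_of_tendsto_metrizable_ae Filter.atTop
    (f := fun n : ℕ => sphericalMaximal (d := d) (Set.Icc 1 2)
      fun z => (Set.Iic (n : ℝ)).indicator g ‖z‖) (fun n => ?_) ?_
  · refine aemeasurable_sphericalMaximal_of_memLp hd (p := 3) (by linarith)
      (hg.indicator measurableSet_Iic) ?_
    have h1 : (fun x : EuclideanSpace ℝ (Fin d) => (Set.Iic (n : ℝ)).indicator g ‖x‖) =
        (Metric.closedBall 0 (n : ℝ)).indicator fun x => g ‖x‖ := by
      funext x
      by_cases hx : ‖x‖ ≤ n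
      · rw [Set.indicator_of_mem (Set.mem_Iic.2 hx), Set.indicator_of_mem (by simpa using hx)]
      · rw [Set.indicator_of_notMem (s := Set.Iic (n : ℝ)) (fun h => hx h), Set.indicator_of_notMem (by simpa using hx)]
    rw [h1, memLp_indicator_iff_restrict Metric.isClosed_closedBall.measurableSet]
    have : IsFiniteMeasure ((volume : Measure (EuclideanSpace ℝ (Fin d))).restrict
        (Metric.closedBall 0 (n : ℝ))) := ⟨by simpa using measure_closedBall_lt_top⟩
    refine MemLp.of_bound (hg.comp measurable_norm).aestronglyMeasurable M.toReal
      (Filter.Eventually.of_forall fun x => ?_)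
    have h2 := ENNReal.toReal_mono hMt (hM ‖x‖)
    simpa using h2
  · refine Filter.Eventually.of_forall fun x => tendsto_const_nhds.congr' ?_
    -- The means at `x` see only points of norm at most `‖x‖ + 2`, so the sequence is eventually
    -- constant.
    filter_upwards [Filter.eventually_ge_atTop ⌈‖x‖ + 2⌉₊] with n hn
    have hn' : ‖x‖ + 2 ≤ n := (Nat.le_ceil _).trans (by exact_mod_cast hn)
    refine iSup_congr fun t => iSup_congr fun ht => ?_
    congr 1
    refine integral_congr_ae (Filter.Eventually.of_forall fun y => ?_)
    have hy : ‖(y : EuclideanSpace ℝ (Fin d))‖ = 1 := by simp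
    have h3 : ‖x - t • (y : EuclideanSpace ℝ (Fin d))‖ ≤ n := by
      refine (norm_sub_le _ _).trans ?_
      rw [norm_smul, hy, Real.norm_eq_abs, abs_of_nonneg (by linarith [ht.1])]
      linarith [ht.2]
    simp only [onSphere]
    rw [Set.indicator_of_mem (Set.mem_Iic.2 h3)]

/-- A radial function in `L^p`, with `p > d / (d - 1)`, agrees off a null set of radii with a
Borel radial function whose spherical means are finite away from the origin. -/
theorem exists_good_representative {d : ℕ} (hd : 2 ≤ d) {p : ℝ≥0∞}
    (hp : p = ∞ ∨ (d : ℝ) < ((d : ℝ) - 1) * p.toReal)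
    {f : EuclideanSpace ℝ (Fin d) → ℂ} (hf : IsRadial f) (hfp : MemLp f p volume) :
    ∃ (g : ℝ → ℂ) (N : Set ℝ), Measurable g ∧ MeasurableSet N ∧
      volume {x : EuclideanSpace ℝ (Fin d) | ‖x‖ ∈ N} = 0 ∧ (∀ x, ‖x‖ ∉ N → f x = g ‖x‖) ∧
      (∀ x : EuclideanSpace ℝ (Fin d), x ≠ 0 → radialMaximal (fun r => ‖g r‖ₑ) x ≠ ∞) ∧
      AEMeasurable (sphericalMaximal (d := d) (Set.Icc 1 2) fun z => g ‖z‖) volume ∧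
      (p = ∞ → ∀ r, ‖g r‖ₑ ≤ eLpNorm f p volume) := by
  have hd' : (2 : ℝ) ≤ d := by exact_mod_cast hd
  obtain ⟨g, N, hg, hN, hN0, hfg⟩ := exists_measurable_radial_representative hd hf hfp.1
  have hae : f =ᵐ[volume] fun x => g ‖x‖ := by
    have : ∀ᵐ x : EuclideanSpace ℝ (Fin d), ‖x‖ ∉ N := by
      rw [ae_iff]
      simpa using hN0
    filter_upwards [this] with x hx using hfg x hx
  by_cases hpt : p = ∞
  · subst hpt
    set M := eLpNorm f ∞ volume
    have hMt : M ≠ ∞ := hfp.2.ne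
    have hT : MeasurableSet {r | M < ‖g r‖ₑ} := measurableSet_lt measurable_const (by fun_prop)
    have hbd : ∀ r, ‖{r | M < ‖g r‖ₑ}ᶜ.indicator g r‖ₑ ≤ M := by
      intro r
      by_cases hr : M < ‖g r‖ₑ
      · rw [Set.indicator_of_notMem (by simpa using hr)]
        simp
      · rw [Set.indicator_of_mem (show r ∈ {r | M < ‖g r‖ₑ}ᶜ from hr)]
        exact not_lt.1 hr
    -- The essential bound is made pointwise by setting the profile to zero at the exceptional
    -- radii, which join the null set.
    refine ⟨{r | M < ‖g r‖ₑ}ᶜ.indicator g, N ∪ {r | M < ‖g r‖ₑ}, hg.indicator hT.compl,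
      hN.union hT, ?_, ?_, fun x _ => ?_, ?_, fun _ => hbd⟩
    · refine measure_mono_null (t := {x | ‖x‖ ∈ N} ∪ {x | M < ‖g ‖x‖‖ₑ}) (fun x hx => hx) ?_
      refine measure_union_null hN0 ?_
      have h1 : ∀ᵐ x : EuclideanSpace ℝ (Fin d), ‖g ‖x‖‖ₑ ≤ M := by
        have h2 := ae_le_eLpNormEssSup (f := f) (μ := volume)
        filter_upwards [h2, hae] with x hx hx'
        rw [← hx']
        simpa [M] using hx
      simpa [ae_iff] using h1
    · intro x hx
      rw [hfg x fun h => hx (Or.inl h), Set.indicator_of_mem]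
      exact fun h => hx (Or.inr h)
    · exact ne_top_of_le_ne_top hMt (radialMaximal_le_of_forall_le hd hbd x)
    · exact aemeasurable_sphericalMaximal_of_bounded hd (hg.indicator hT.compl) hMt hbd
  · have hp' : (d : ℝ) < ((d : ℝ) - 1) * p.toReal := hp.resolve_left hpt
    have hp0 : 0 < p.toReal := by nlinarith [ENNReal.toReal_nonneg (a := p)]
    have hpe : p ≠ 0 := fun h => by simp [h] at hp0
    have hgp : MemLp (fun x : EuclideanSpace ℝ (Fin d) => g ‖x‖) p volume :=
      (memLp_congr_ae hae).1 hfp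
    refine ⟨g, N, hg, hN, hN0, hfg, fun x hx => ?_, ?_, fun h => absurd h hpt⟩
    · refine radialMaximal_ne_top hd hp' (by fun_prop) ?_ hx
      have h1 := lintegral_rpow_enorm_lt_top_of_eLpNorm_lt_top hpe hpt hgp.2
      exact h1.ne
    · refine aemeasurable_sphericalMaximal_of_memLp hd hp' hg ?_
      rwa [ENNReal.ofReal_toReal hpt]

theorem integrable_onSphere_of_memLp {d : ℕ} (hd : 2 ≤ d) {p : ℝ≥0∞}
    (hp : p = ∞ ∨ (d : ℝ) < ((d : ℝ) - 1) * p.toReal)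
    {f : EuclideanSpace ℝ (Fin d) → ℂ} (hf : IsRadial f) (hfp : MemLp f p volume)
    {x : EuclideanSpace ℝ (Fin d)} (hx : x ≠ 0) {t : ℝ} (ht : t ∈ Set.Icc (1 : ℝ) 2) :
    Integrable (onSphere f t x) (sphereMeasure d) := by
  obtain ⟨g, N, hg, hN, hN0, hfg, hfin, -, -⟩ := exists_good_representative hd hp hf hfp
  exact (integrable_onSphere hg (hfin x hx) ht).congr (onSphere_ae_eq hd hN hN0 hfg hx ht).symm

/-! ### Sufficiency: boundedness inside the triangle and at the origin. -/

theorem ae_ne_zero_euclidean {d : ℕ} (hd : 2 ≤ d) : ∀ᵐ x : EuclideanSpace ℝ (Fin d), x ≠ 0 := by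
  have := nontrivial_euclidean hd
  simp [ae_iff]

theorem isRadialStrongType_top {d : ℕ} (hd : 2 ≤ d) : IsRadialStrongType d (Set.Icc 1 2) ∞ ∞ := by
  refine ⟨1, fun f hf hfp => ?_⟩
  obtain ⟨g, N, hg, hN, hN0, hfg, hfin, hm, hbd⟩ :=
    exists_good_representative hd (Or.inl rfl) hf hfp
  have hae : sphericalMaximal (Set.Icc 1 2) f =ᵐ[volume]
      sphericalMaximal (Set.Icc 1 2) fun z => g ‖z‖ := by
    filter_upwards [ae_ne_zero_euclidean hd] with x hx using sphericalMaximal_eq hd hN hN0 hfg hx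
  refine ⟨hm.congr hae.symm, ?_⟩
  rw [eLpNorm_congr_ae hae, ENNReal.coe_one, one_mul]
  nth_rewrite 1 [eLpNorm_exponent_top]
  refine essSup_le_of_ae_le _ (Filter.Eventually.of_forall fun x => ?_)
  simp only [enorm_eq_self]
  exact (sphericalMaximal_le_radialMaximal g x).trans
    (radialMaximal_le_of_forall_le hd (hbd rfl) x)

theorem isRadialStrongType_of_lt {d : ℕ} (hd : 2 ≤ d) {p : ℝ} (hp : (d : ℝ) < ((d : ℝ) - 1) * p)
    {k : ℝ} (hk : 1 ≤ k) (hkd : k ≤ d) :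
    IsRadialStrongType d (Set.Icc 1 2) (ENNReal.ofReal p) (ENNReal.ofReal (k * p)) := by
  have hd' : (2 : ℝ) ≤ d := by exact_mod_cast hd
  have hp0 : 0 < p := by nlinarith
  have hkp : 0 < k * p := by positivity
  obtain ⟨C, hC, H⟩ := lintegral_rpow_le_of_le_radialMaximal hd hp hk hkd
  have hC' : C ^ (1 / (k * p)) ≠ ∞ := ENNReal.rpow_ne_top_of_nonneg (by positivity) hC
  refine ⟨(C ^ (1 / (k * p))).toNNReal, fun f hf hfp => ?_⟩
  obtain ⟨g, N, hg, hN, hN0, hfg, hfin, hm, -⟩ :=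
    exists_good_representative hd (Or.inr (by rwa [ENNReal.toReal_ofReal hp0.le])) hf hfp
  have hae : sphericalMaximal (Set.Icc 1 2) f =ᵐ[volume]
      sphericalMaximal (Set.Icc 1 2) fun z => g ‖z‖ := by
    filter_upwards [ae_ne_zero_euclidean hd] with x hx using sphericalMaximal_eq hd hN hN0 hfg hx
  have hfae : f =ᵐ[volume] fun x => g ‖x‖ := by
    have : ∀ᵐ x : EuclideanSpace ℝ (Fin d), ‖x‖ ∉ N := by
      rw [ae_iff]
      simpa using hN0
    filter_upwards [this] with x hx using hfg x hx
  refine ⟨hm.congr hae.symm, ?_⟩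
  have h1 := H (sphericalMaximal (Set.Icc 1 2) fun z => g ‖z‖) (fun r => ‖g r‖ₑ) hm
    (by fun_prop) (by
      filter_upwards [ae_ne_zero_euclidean hd] with x hx
      exact ne_top_of_le_ne_top (hfin x hx) (sphericalMaximal_le_radialMaximal g x))
    fun x _ => sphericalMaximal_le_radialMaximal g x
  rw [eLpNorm_congr_ae hae, eLpNorm_congr_ae hfae, ENNReal.coe_toNNReal hC',
    eLpNorm_eq_lintegral_rpow_enorm_toReal (ENNReal.ofReal_pos.2 hkp).ne' ENNReal.ofReal_ne_top,
    eLpNorm_eq_lintegral_rpow_enorm_toReal (ENNReal.ofReal_pos.2 hp0).ne' ENNReal.ofReal_ne_top,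
    ENNReal.toReal_ofReal hkp.le, ENNReal.toReal_ofReal hp0.le]
  simp only [enorm_eq_self]
  refine (ENNReal.rpow_le_rpow h1 (by positivity)).trans (le_of_eq ?_)
  rw [ENNReal.mul_rpow_of_nonneg _ _ (by positivity), ← ENNReal.rpow_mul]
  congr 2
  field_simp

/-! ### Necessity: large balls and thin annuli. -/

/-- All three necessary conditions are read off by comparing growth as a parameter `R` tends to
infinity. -/
theorem exponent_le_of_forall_mul_rpow_le {K₁ K₂ : ℝ≥0∞} (h₁ : K₁ ≠ 0) (h₁t : K₁ ≠ ∞)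
    (h₂ : K₂ ≠ ∞) {α β R₀ : ℝ} (h : ∀ R : ℝ, R₀ ≤ R →
      K₁ * ENNReal.ofReal (R ^ α) ≤ K₂ * ENNReal.ofReal (R ^ β)) : α ≤ β := by
  by_contra! hlt
  have ht := tendsto_rpow_atTop (sub_pos.2 hlt)
  obtain ⟨R, hR, hR0, hR1⟩ := ((ht.eventually_gt_atTop (K₂.toReal / K₁.toReal)).and
    ((Filter.eventually_ge_atTop R₀).and (Filter.eventually_gt_atTop 0))).exists
  have hpos := ENNReal.toReal_pos h₁ h₁t
  have h3 := ENNReal.toReal_mono (by finiteness) (h R hR0)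
  rw [ENNReal.toReal_mul, ENNReal.toReal_mul, ENNReal.toReal_ofReal (by positivity),
    ENNReal.toReal_ofReal (by positivity)] at h3
  rw [div_lt_iff₀ hpos, Real.rpow_sub hR1, div_mul_eq_mul_div, lt_div_iff₀ (by positivity)] at hR
  linarith

/-- The exponent `1/q` covers `q = ∞` as well, where the measure is raised to the power zero; hence
the requirement that `T` be non-null. -/
theorem mul_measure_rpow_le_eLpNorm {X : Type*} [MeasurableSpace X] {μ : Measure X} {q : ℝ≥0∞}
    (hq : q ≠ 0) {G : X → ℝ≥0∞} {T : Set X} (hT : MeasurableSet T) (hT0 : μ T ≠ 0) {κ : ℝ≥0∞}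
    (hκ : ∀ x ∈ T, κ ≤ G x) : κ * μ T ^ (q⁻¹).toReal ≤ eLpNorm G q μ := by
  have h1 := eLpNorm_indicator_const' (c := κ) hT hT0 hq
  rw [enorm_eq_self, one_div, ← ENNReal.toReal_inv] at h1
  rw [← h1]
  refine eLpNorm_mono_enorm fun x => ?_
  simp only [enorm_eq_self]
  by_cases hx : x ∈ T
  · rw [Set.indicator_of_mem hx]
    exact hκ x hx
  · simp [hx]

/-- The test function is the indicator of `{‖x‖ ∈ S}`: unit spheres centred in `T` lie inside this
set, so the radius `t = 1` already gives maximal function at least one on `T`. -/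
theorem measure_rpow_le_of_isRadialStrongType {d : ℕ} (hd : 2 ≤ d) {p q : ℝ≥0∞} (hp : p ≠ 0)
    (hq : q ≠ 0) {C : ℝ≥0} (hC : ∀ f : EuclideanSpace ℝ (Fin d) → ℂ, IsRadial f →
      MemLp f p volume → AEMeasurable (sphericalMaximal (Set.Icc 1 2) f) volume ∧
      eLpNorm (sphericalMaximal (Set.Icc 1 2) f) q volume ≤ C * eLpNorm f p volume)
    {S : Set ℝ} (hS : MeasurableSet S)
    (hS0 : volume {x : EuclideanSpace ℝ (Fin d) | ‖x‖ ∈ S} ≠ 0)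
    (hSt : volume {x : EuclideanSpace ℝ (Fin d) | ‖x‖ ∈ S} ≠ ∞)
    {T : Set (EuclideanSpace ℝ (Fin d))} (hT : MeasurableSet T) (hT0 : volume T ≠ 0)
    (hTS : ∀ x ∈ T, ∀ y : EuclideanSpace ℝ (Fin d), ‖y‖ = 1 → ‖x - y‖ ∈ S) :
    volume T ^ (q⁻¹).toReal ≤
      C * volume {x : EuclideanSpace ℝ (Fin d) | ‖x‖ ∈ S} ^ (p⁻¹).toReal := by
  have := isProbabilityMeasure_sphereMeasure hd
  have hS' : MeasurableSet {x : EuclideanSpace ℝ (Fin d) | ‖x‖ ∈ S} := measurable_norm hS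
  set f : EuclideanSpace ℝ (Fin d) → ℂ := {x | ‖x‖ ∈ S}.indicator fun _ => 1
  have hf : IsRadial f := by
    intro x y hxy
    change S.indicator (fun _ => (1 : ℂ)) ‖x‖ = S.indicator (fun _ => 1) ‖y‖
    rw [hxy]
  have hfp : MemLp f p volume := memLp_indicator_const p hS' 1 (Or.inr hSt)
  have h1 := (hC f hf hfp).2
  rw [eLpNorm_indicator_const' hS' hS0 hp, one_div, ← ENNReal.toReal_inv, enorm_one, one_mul] at h1
  refine le_trans ?_ h1
  rw [← one_mul (volume T ^ _)]
  refine mul_measure_rpow_le_eLpNorm hq hT hT0 fun x hx => ?_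
  refine le_trans (le_of_eq ?_) (le_iSup₂ (f := fun (t : ℝ) (_ : t ∈ Set.Icc (1 : ℝ) 2) =>
    ‖sphericalMean f t x‖ₑ) 1 ⟨le_rfl, by norm_num⟩)
  have h2 : ∀ y, onSphere f 1 x y = 1 := fun y => by
    simp only [onSphere, one_smul, f]
    exact Set.indicator_of_mem (s := S) (hTS x hx y (by simp)) fun _ => (1 : ℂ)
  simp [sphericalMean, h2]

theorem volume_closedBall_zero_rpow {d : ℕ} (hd : 2 ≤ d) {r : ℝ} (hr : 0 < r) (b : ℝ) (hb : 0 ≤ b) :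
    volume (Metric.closedBall (0 : EuclideanSpace ℝ (Fin d)) r) ^ b =
      volume (Metric.ball (0 : EuclideanSpace ℝ (Fin d)) 1) ^ b * ENNReal.ofReal (r ^ (d * b)) := by
  have := nontrivial_euclidean hd
  rw [Measure.addHaar_closedBall _ _ hr.le, finrank_euclideanSpace, Fintype.card_fin,
    ENNReal.mul_rpow_of_nonneg _ _ hb, ENNReal.ofReal_rpow_of_pos (by positivity), mul_comm,
    ← Real.rpow_natCast, ← Real.rpow_mul hr.le]

/-- Unit spheres centred in the ball of radius `R / 2` stay in the ball of radius `R` when `R ≥ 2`;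
this gives `R^{d/q} ≲ R^{d/p}`. -/
theorem inv_toReal_le_of_isRadialStrongType {d : ℕ} (hd : 2 ≤ d) {p q : ℝ≥0∞} (hp : p ≠ 0)
    (hq : q ≠ 0) (h : IsRadialStrongType d (Set.Icc 1 2) p q) :
    (q⁻¹).toReal ≤ (p⁻¹).toReal := by
  have := nontrivial_euclidean hd
  obtain ⟨C, hC⟩ := h
  set V := volume (Metric.ball (0 : EuclideanSpace ℝ (Fin d)) 1)
  have hV0 : V ≠ 0 := (Metric.measure_ball_pos _ _ one_pos).ne'
  have hVt : V ≠ ∞ := measure_ball_lt_top.ne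
  set a := (p⁻¹).toReal
  set b := (q⁻¹).toReal
  have ha : 0 ≤ a := ENNReal.toReal_nonneg
  have hb : 0 ≤ b := ENNReal.toReal_nonneg
  have hd0 : (0 : ℝ) < d := by exact_mod_cast (by omega : 0 < d)
  have key : d * b ≤ d * a := by
    refine exponent_le_of_forall_mul_rpow_le
      (K₁ := V ^ b * ENNReal.ofReal ((1 / 2) ^ (d * b))) (K₂ := C * V ^ a) (R₀ := 2) ?_ ?_ ?_ ?_
    · exact mul_ne_zero (by simp [hV0, hVt]) (ENNReal.ofReal_pos.2 (by positivity)).ne'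
    · exact ENNReal.mul_ne_top (ENNReal.rpow_ne_top_of_nonneg hb hVt) (by finiteness)
    · exact ENNReal.mul_ne_top (by finiteness) (ENNReal.rpow_ne_top_of_nonneg ha hVt)
    intro R hR
    have hR0 : 0 < R := by linarith
    have hSeq : {x : EuclideanSpace ℝ (Fin d) | ‖x‖ ∈ Set.Iic R} = Metric.closedBall 0 R := by
      ext x
      simp
    have h1 := measure_rpow_le_of_isRadialStrongType hd hp hq hC (S := Set.Iic R)
      (T := Metric.closedBall 0 (1 / 2 * R)) measurableSet_Iic
      (by rw [hSeq]; exact (Metric.measure_closedBall_pos _ _ hR0).ne')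
      (by rw [hSeq]; exact measure_closedBall_lt_top.ne)
      Metric.isClosed_closedBall.measurableSet
      (Metric.measure_closedBall_pos _ _ (by positivity)).ne'
      (fun x hx y hy => by
        rw [mem_closedBall_zero_iff] at hx
        refine (norm_sub_le _ _).trans ?_
        rw [hy]
        linarith)
    rw [hSeq, volume_closedBall_zero_rpow hd (by positivity) _ hb,
      volume_closedBall_zero_rpow hd hR0 _ ha, Real.mul_rpow (by norm_num) hR0.le,
      ENNReal.ofReal_mul (by positivity), ← mul_assoc, ← mul_assoc] at h1
    exact h1
  exact le_of_mul_le_mul_left key hd0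

theorem volume_annulus_le {d : ℕ} (hd : 2 ≤ d) {r : ℝ} (hr1 : r ≤ 1) :
    volume {x : EuclideanSpace ℝ (Fin d) | ‖x‖ ∈ {s : ℝ | |s - 1| ≤ r}} ≤
      (volume : Measure (EuclideanSpace ℝ (Fin d))).toSphere Set.univ *
        ENNReal.ofReal (2 ^ d * r) := by
  have hS : MeasurableSet {s : ℝ | |s - 1| ≤ r} := measurableSet_le (by fun_prop) measurable_const
  have h0 := toSphere_univ_ne_zero hd
  have ht := measure_ne_top (volume : Measure (EuclideanSpace ℝ (Fin d))).toSphere Set.univ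
  have h1 := setLIntegral_comp_norm hd hS (h := 1) measurable_one
  simp only [Pi.one_apply, mul_one, lintegral_one, Measure.restrict_apply_univ] at h1
  have h2 : ∫⁻ s in Set.Ioi 0 ∩ {s : ℝ | |s - 1| ≤ r}, ENNReal.ofReal (s ^ (d - 1)) ≤
      ENNReal.ofReal (2 ^ d * r) := by
    calc _ ≤ ∫⁻ s in Set.Icc (1 - r) (1 + r), ENNReal.ofReal (2 ^ (d - 1)) := by
          refine (lintegral_mono_set' (t := Set.Ioi 0 ∩ Set.Icc (1 - r) (1 + r)) ?_).trans ?_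
          · refine Filter.Eventually.of_forall fun s hs => ⟨hs.1, ?_⟩
            have := abs_le.1 (show |s - 1| ≤ r from hs.2)
            constructor <;> linarith
          · refine (setLIntegral_mono measurable_const fun s hs =>
              ENNReal.ofReal_le_ofReal (pow_le_pow_left₀ (le_of_lt hs.1) ?_ _)).trans
              (lintegral_mono_set Set.inter_subset_right)
            linarith [hs.2.2]
      _ = ENNReal.ofReal (2 ^ (d - 1)) * ENNReal.ofReal (2 * r) := by
          rw [setLIntegral_const, Real.volume_Icc]
          congr 2
          ring
      _ = _ := by
          rw [← ENNReal.ofReal_mul (by positivity), ← mul_assoc, ← pow_succ,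
            show d - 1 + 1 = d by omega]
  rw [h1] at h2
  calc _ = (volume : Measure (EuclideanSpace ℝ (Fin d))).toSphere Set.univ *
        (((volume : Measure (EuclideanSpace ℝ (Fin d))).toSphere Set.univ)⁻¹ * _) := by
        rw [← mul_assoc, ENNReal.mul_inv_cancel h0 ht, one_mul]
    _ ≤ _ := mul_le_mul_right h2 _

/-- Unit spheres centred within `1/R` of the origin lie in the annulus of half-width `1/R` about the
unit sphere, which has measure `O(1/R)`; this gives `R^{-d/q} ≲ R^{-1/p}`. -/
theorem inv_toReal_le_mul_of_isRadialStrongType {d : ℕ} (hd : 2 ≤ d) {p q : ℝ≥0∞} (hp : p ≠ 0)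
    (hq : q ≠ 0) (h : IsRadialStrongType d (Set.Icc 1 2) p q) :
    (p⁻¹).toReal ≤ d * (q⁻¹).toReal := by
  have := nontrivial_euclidean hd
  obtain ⟨C, hC⟩ := h
  set V := volume (Metric.ball (0 : EuclideanSpace ℝ (Fin d)) 1)
  have hV0 : V ≠ 0 := (Metric.measure_ball_pos _ _ one_pos).ne'
  have hVt : V ≠ ∞ := measure_ball_lt_top.ne
  set a := (p⁻¹).toReal
  set b := (q⁻¹).toReal
  have ha : 0 ≤ a := ENNReal.toReal_nonneg
  have hb : 0 ≤ b := ENNReal.toReal_nonneg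
  set c := (volume : Measure (EuclideanSpace ℝ (Fin d))).toSphere Set.univ
  have hct : c * ENNReal.ofReal (2 ^ d) ≠ ∞ := by
    have : c ≠ ∞ := measure_ne_top _ _
    finiteness
  have key : -(d * b) ≤ -a := by
    refine exponent_le_of_forall_mul_rpow_le (K₁ := V ^ b)
      (K₂ := C * (c * ENNReal.ofReal (2 ^ d)) ^ a) (R₀ := 1) (by simp [hV0, hVt])
      (ENNReal.rpow_ne_top_of_nonneg hb hVt)
      (ENNReal.mul_ne_top (by finiteness) (ENNReal.rpow_ne_top_of_nonneg ha hct)) ?_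
    intro R hR
    have hR0 : 0 < R := by linarith
    have hr : 0 < R⁻¹ := by positivity
    have hr1 : R⁻¹ ≤ 1 := inv_le_one_of_one_le₀ hR
    have hvol := volume_annulus_le hd hr1
    have h1 := measure_rpow_le_of_isRadialStrongType hd hp hq hC (S := {s : ℝ | |s - 1| ≤ R⁻¹})
      (T := Metric.closedBall 0 R⁻¹) (measurableSet_le (by fun_prop) measurable_const)
      (by
        obtain ⟨e, he⟩ := exists_norm_eq_one_euclidean hd
        have ho : IsOpen {x : EuclideanSpace ℝ (Fin d) | |‖x‖ - 1| < R⁻¹} :=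
          isOpen_lt (by fun_prop) continuous_const
        refine (lt_of_lt_of_le (ho.measure_pos volume ⟨e, by simp [he, hR0]⟩)
          (measure_mono fun x hx => ?_)).ne'
        exact le_of_lt (show |‖x‖ - 1| < R⁻¹ from hx))
      (ne_top_of_le_ne_top (by
        have : c ≠ ∞ := measure_ne_top _ _
        finiteness) hvol)
      Metric.isClosed_closedBall.measurableSet
      (Metric.measure_closedBall_pos _ _ hr).ne'
      (fun x hx y hy => by
        rw [mem_closedBall_zero_iff] at hx
        have h2 := abs_norm_sub_norm_le (x - y) (-y)
        rw [norm_neg, hy, sub_neg_eq_add, sub_add_cancel] at h2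
        exact h2.trans hx)
    rw [volume_closedBall_zero_rpow hd hr _ hb] at h1
    rw [Real.rpow_neg hR0.le, ← Real.inv_rpow hR0.le]
    refine h1.trans ?_
    rw [mul_assoc]
    refine mul_le_mul_right ((ENNReal.rpow_le_rpow hvol ha).trans (le_of_eq ?_)) _
    rw [ENNReal.ofReal_mul (by positivity), ← mul_assoc, ENNReal.mul_rpow_of_nonneg _ _ ha,
      ENNReal.ofReal_rpow_of_pos hr, Real.rpow_neg hR0.le, Real.inv_rpow hR0.le]
  linarith

/-! ### Necessity: logarithmic blow-up at the critical exponent. -/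

/-- The critical profile `s ^ (-(d - 1))`, truncated to `a < s < 1 / 2`. -/
noncomputable def truncatedPower (d : ℕ) (a : ℝ) : ℝ → ℝ :=
  (Set.Ioo a (1 / 2)).indicator fun s => (s ^ (d - 1))⁻¹

theorem measurable_truncatedPower (d : ℕ) (a : ℝ) : Measurable (truncatedPower d a) :=
  Measurable.indicator (by fun_prop) measurableSet_Ioo

theorem truncatedPower_nonneg {d : ℕ} {a : ℝ} (ha : 0 < a) (s : ℝ) : 0 ≤ truncatedPower d a s := by
  refine Set.indicator_nonneg (fun s hs => ?_) s
  have := ha.trans hs.1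
  positivity

theorem truncatedPower_le {d : ℕ} {a : ℝ} (ha : 0 < a) (s : ℝ) :
    truncatedPower d a s ≤ (a ^ (d - 1))⁻¹ := by
  by_cases hs : s ∈ Set.Ioo a (1 / 2)
  · rw [truncatedPower, Set.indicator_of_mem hs]
    exact inv_anti₀ (by positivity) (pow_le_pow_left₀ ha.le hs.1.le _)
  · rw [truncatedPower, Set.indicator_of_notMem hs]
    positivity

theorem lintegral_inv_Ioo {a b : ℝ} (ha : 0 < a) (hab : a ≤ b) :
    ∫⁻ s in Set.Ioo a b, ENNReal.ofReal s⁻¹ = ENNReal.ofReal (Real.log (b / a)) := by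
  have hb : 0 < b := ha.trans_le hab
  have hint : IntegrableOn (fun s : ℝ => s⁻¹) (Set.Ioc a b) := by
    rw [← intervalIntegrable_iff_integrableOn_Ioc_of_le hab, intervalIntegrable_inv_iff]
    right
    rw [Set.uIcc_of_le hab]
    exact fun h => absurd h.1 (not_le.2 ha)
  rw [setLIntegral_congr Ioo_ae_eq_Ioc, ← ofReal_integral_eq_lintegral_ofReal hint,
    ← intervalIntegral.integral_of_le hab, integral_inv_of_pos ha hb]
  filter_upwards [ae_restrict_mem measurableSet_Ioc] with s hs
  have := ha.trans hs.1
  simp only [Pi.zero_apply]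
  positivity

/-- At the exponent `d / (d - 1)` the profile becomes `s^{-d}`, and the polar Jacobian leaves `1/s`.
-/
theorem lintegral_truncatedPower_rpow {d : ℕ} (hd : 2 ≤ d) {a : ℝ} (ha : 0 < a) (ha2 : a ≤ 1 / 2) :
    ∫⁻ x : EuclideanSpace ℝ (Fin d),
      ENNReal.ofReal (truncatedPower d a ‖x‖) ^ ((d : ℝ) / (d - 1)) =
    (volume : Measure (EuclideanSpace ℝ (Fin d))).toSphere Set.univ *
      ENNReal.ofReal (Real.log (1 / 2 / a)) := by
  have := nontrivial_euclidean hd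
  have hd' : (2 : ℝ) ≤ d := by exact_mod_cast hd
  have hm := measurable_truncatedPower d a
  rw [lintegral_comp_norm volume
    (h := fun s => ENNReal.ofReal (truncatedPower d a s) ^ ((d : ℝ) / (d - 1))) (by fun_prop),
    finrank_euclideanSpace, Fintype.card_fin, ← lintegral_inv_Ioo ha ha2]
  congr 1
  have hsub : Set.Ioo a (1 / 2) ⊆ Set.Ioi 0 := fun s hs => ha.trans hs.1
  rw [← Set.inter_eq_left.2 hsub, ← Measure.restrict_restrict measurableSet_Ioo,
    ← lintegral_indicator measurableSet_Ioo]
  refine setLIntegral_congr_fun measurableSet_Ioi fun s hs => ?_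
  have hs0 : 0 < s := hs
  have hpos : 0 < (d : ℝ) / (d - 1) := div_pos (by linarith) (by linarith)
  by_cases hsm : s ∈ Set.Ioo a (1 / 2)
  · have h1 : ((s ^ (d - 1))⁻¹) ^ ((d : ℝ) / (d - 1)) = (s ^ d)⁻¹ := by
      rw [Real.inv_rpow (by positivity), ← Real.rpow_natCast, ← Real.rpow_mul hs0.le,
        Nat.cast_sub (by omega : 1 ≤ d), Nat.cast_one, mul_div_cancel₀ _ (by linarith),
        Real.rpow_natCast]
    simp only [truncatedPower]
    rw [Set.indicator_of_mem hsm, Set.indicator_of_mem hsm,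
      ENNReal.ofReal_rpow_of_pos (by positivity), h1, ← ENNReal.ofReal_mul (by positivity)]
    congr 1
    nth_rewrite 2 [show d = d - 1 + 1 by omega]
    rw [pow_succ]
    field_simp
  · simp only [truncatedPower]
    rw [Set.indicator_of_notMem hsm, Set.indicator_of_notMem hsm, ENNReal.ofReal_zero,
      ENNReal.zero_rpow_of_pos hpos, mul_zero]

/-- A sphere through the origin has chord comparable to `θ` for small `θ`, between `θ / 2` and `2
θ`. On `2a < θ < 1/4` the chord therefore lies in `(a, 1/2)`, and the integrand is at least a
multiple of `θ^{d-2} θ^{-(d-1)} = 1/θ`. -/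
theorem ofReal_log_le_lintegral_chord {d : ℕ} (hd : 2 ≤ d) {a t : ℝ} (ha : 0 < a)
    (ha8 : a ≤ 1 / 8) (ht : t ∈ Set.Icc (1 : ℝ) 2) :
    ENNReal.ofReal ((1 / 2) ^ (d - 2) * (1 / 2) ^ (d - 1)) *
      ENNReal.ofReal (Real.log (1 / 4 / (2 * a))) ≤
    ∫⁻ θ in Set.Ioo 0 Real.pi, ENNReal.ofReal (Real.sin θ ^ (d - 2)) *
      ENNReal.ofReal (truncatedPower d a (chord t t θ)) := by
  have hpi := Real.pi_gt_three
  have hpi4 := Real.pi_le_four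
  have hm := measurable_truncatedPower d a
  have hc := (continuous_chord t t).measurable
  rw [← lintegral_inv_Ioo (by positivity) (by linarith), ← lintegral_const_mul _ (by fun_prop)]
  refine (setLIntegral_mono (by fun_prop) fun θ hθ => ?_).trans
    (lintegral_mono_set (s := Set.Ioo (2 * a) (1 / 4)) fun θ hθ => ⟨by linarith [hθ.1], by
      linarith [hθ.2]⟩)
  have hθ0 : 0 < θ := by linarith [hθ.1]
  have hsin : θ / 2 ≤ Real.sin θ := by
    refine le_trans ?_ (Real.mul_le_sin hθ0.le (by linarith [hθ.2]))
    rw [div_mul_eq_mul_div, le_div_iff₀ (by linarith)]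
    nlinarith
  have hs0 : 0 < Real.sin θ := by linarith
  have hlow : θ / 2 ≤ chord t t θ :=
    le_trans (by nlinarith [ht.1]) mul_sin_le_chord
  have hup : chord t t θ ≤ 2 * θ := by
    refine Real.sqrt_le_iff.2 ⟨by positivity, ?_⟩
    have h1 := Real.one_sub_sq_div_two_le_cos (x := θ)
    have h2 : t ^ 2 ≤ 4 := by nlinarith [ht.1, ht.2]
    have h3 : 0 ≤ t ^ 2 := sq_nonneg t
    calc _ = 2 * t ^ 2 * (1 - Real.cos θ) := by ring
      _ ≤ 2 * t ^ 2 * (θ ^ 2 / 2) := mul_le_mul_of_nonneg_left (by linarith) (by positivity)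
      _ ≤ _ := by nlinarith [sq_nonneg θ]
  have hmem : chord t t θ ∈ Set.Ioo a (1 / 2) :=
    ⟨by linarith [hθ.1], by linarith [hθ.2]⟩
  have hc0 : 0 < chord t t θ := by linarith
  rw [truncatedPower, Set.indicator_of_mem hmem, ← ENNReal.ofReal_mul (by positivity),
    ← ENNReal.ofReal_mul (by positivity)]
  refine ENNReal.ofReal_le_ofReal ?_
  calc (1 / 2) ^ (d - 2) * (1 / 2) ^ (d - 1) * θ⁻¹ = (θ / 2) ^ (d - 2) * ((2 * θ) ^ (d - 1))⁻¹ := by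
        rw [show d - 1 = d - 2 + 1 by omega]
        simp only [div_pow, mul_pow, pow_succ, one_pow]
        field_simp
    _ ≤ _ := mul_le_mul (pow_le_pow_left₀ (by positivity) hsin _)
        (inv_anti₀ (by positivity) (pow_le_pow_left₀ hc0.le hup _)) (by positivity) (by positivity)

/-- The radius is chosen as `t = ‖x‖`, so that the sphere passes through the singularity of the
profile. -/
theorem ofReal_log_le_sphericalMaximal {d : ℕ} (hd : 2 ≤ d) {a : ℝ} (ha : 0 < a)
    (ha8 : a ≤ 1 / 8) {x : EuclideanSpace ℝ (Fin d)} (hx : ‖x‖ ∈ Set.Icc (1 : ℝ) 2) :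
    zonalConst d * (ENNReal.ofReal ((1 / 2) ^ (d - 2) * (1 / 2) ^ (d - 1)) *
      ENNReal.ofReal (Real.log (1 / 4 / (2 * a)))) ≤
    sphericalMaximal (Set.Icc 1 2) (fun z => (truncatedPower d a ‖z‖ : ℂ)) x := by
  have := isProbabilityMeasure_sphereMeasure hd
  have hm := measurable_truncatedPower d a
  have hx0 : x ≠ 0 := norm_pos_iff.1 (by linarith [hx.1])
  have h1 := lintegral_sphereMeasure_norm_sub hd hx0 ‖x‖
    (h := fun s => ENNReal.ofReal (truncatedPower d a s)) (by fun_prop)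
  refine (mul_le_mul_right (ofReal_log_le_lintegral_chord hd ha ha8 hx) _).trans ?_
  rw [← h1]
  refine le_trans (le_of_eq ?_) (le_iSup₂ (f := fun (t : ℝ) (_ : t ∈ Set.Icc (1 : ℝ) 2) =>
    ‖sphericalMean (fun z => (truncatedPower d a ‖z‖ : ℂ)) t x‖ₑ) ‖x‖ hx)
  have hmy : Measurable fun y : Metric.sphere (0 : EuclideanSpace ℝ (Fin d)) 1 =>
      truncatedPower d a ‖x - ‖x‖ • (y : EuclideanSpace ℝ (Fin d))‖ :=
    hm.comp (by fun_prop)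
  have hint : Integrable (fun y : Metric.sphere (0 : EuclideanSpace ℝ (Fin d)) 1 =>
      truncatedPower d a ‖x - ‖x‖ • (y : EuclideanSpace ℝ (Fin d))‖) (sphereMeasure d) :=
    Integrable.of_bound hmy.aestronglyMeasurable (a ^ (d - 1))⁻¹
      (Filter.Eventually.of_forall fun y => by
        rw [Real.norm_eq_abs, abs_of_nonneg (truncatedPower_nonneg ha _)]
        exact truncatedPower_le ha _)
  have hnn : ∀ y : Metric.sphere (0 : EuclideanSpace ℝ (Fin d)) 1,
      0 ≤ truncatedPower d a ‖x - ‖x‖ • (y : EuclideanSpace ℝ (Fin d))‖ :=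
    fun y => truncatedPower_nonneg ha _
  rw [← ofReal_integral_eq_lintegral_ofReal hint (Filter.Eventually.of_forall hnn)]
  have h2 : sphericalMean (fun z => (truncatedPower d a ‖z‖ : ℂ)) ‖x‖ x =
      ((∫ y, truncatedPower d a ‖x - ‖x‖ • (y : EuclideanSpace ℝ (Fin d))‖
        ∂(sphereMeasure d) : ℝ) : ℂ) := by
    rw [sphericalMean, ← integral_complex_ofReal]
    rfl
  rw [h2, ← ofReal_norm, Complex.norm_real, Real.norm_eq_abs, abs_of_nonneg (integral_nonneg hnn)]

/-- Otherwise `p ≤ d / (d - 1) = ps`, and on the unit ball, which contains the supports of the test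
functions, the `L^p` norm is controlled by the `L^ps` norm. With `R` comparable to `log (1/a)`,
boundedness would give `R ≲ R^{1/ps}`, although `1/ps < 1`. -/
theorem inv_toReal_lt_of_isRadialStrongType {d : ℕ} (hd : 2 ≤ d) {p q : ℝ≥0∞} (hq : q ≠ 0) (h : IsRadialStrongType d (Set.Icc 1 2) p q) :
    (p⁻¹).toReal < ((d : ℝ) - 1) / d := by
  by_contra! hcon
  have := nontrivial_euclidean hd
  have hd' : (2 : ℝ) ≤ d := by exact_mod_cast hd
  obtain ⟨C, hC⟩ := h
  set ps : ℝ := (d : ℝ) / (d - 1)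
  have hps : 0 < ps := div_pos (by linarith) (by linarith)
  have hpps : p ≤ ENNReal.ofReal ps := by
    have h1 : 0 < (p⁻¹).toReal := lt_of_lt_of_le (div_pos (by linarith) (by linarith)) hcon
    have hpt : p ≠ ∞ := fun h => by simp [h] at h1
    rw [ENNReal.le_ofReal_iff_toReal_le hpt hps.le]
    rw [ENNReal.toReal_inv] at hcon h1
    have h2 := inv_anti₀ (div_pos (by linarith) (by linarith)) hcon
    rwa [inv_inv, inv_div] at h2
  set A := {x : EuclideanSpace ℝ (Fin d) | ‖x‖ ∈ Set.Icc (1 : ℝ) 2}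
  have hAm : MeasurableSet A := measurable_norm measurableSet_Icc
  have hA0 : volume A ≠ 0 := by
    obtain ⟨e, he⟩ := exists_norm_eq_one_euclidean hd
    have ho : IsOpen {x : EuclideanSpace ℝ (Fin d) | ‖x‖ ∈ Set.Ioo (1 : ℝ) 2} :=
      isOpen_Ioo.preimage continuous_norm
    refine (lt_of_lt_of_le (ho.measure_pos volume ⟨(3 / 2 : ℝ) • e, ?_⟩)
      (measure_mono fun x hx =>
        (⟨(show ‖x‖ ∈ Set.Ioo (1 : ℝ) 2 from hx).1.le, hx.2.le⟩ : ‖x‖ ∈ Set.Icc (1 : ℝ) 2))).ne'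
    change ‖(3 / 2 : ℝ) • e‖ ∈ Set.Ioo (1 : ℝ) 2
    rw [norm_smul, he]
    norm_num
  have hAt : volume A ≠ ∞ := ne_top_of_le_ne_top
    (measure_closedBall_lt_top (x := (0 : EuclideanSpace ℝ (Fin d))) (r := 2)).ne
    (measure_mono fun x hx => mem_closedBall_zero_iff.2 hx.2)
  set Bl := Metric.ball (0 : EuclideanSpace ℝ (Fin d)) 1
  set c := (volume : Measure (EuclideanSpace ℝ (Fin d))).toSphere Set.univ
  have hct : c ≠ ∞ := measure_ne_top _ _
  -- The factor from Hölder's inequality on the unit ball in passing from exponent `ps` to `p`.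
  set W := volume Bl ^ (1 / p.toReal - 1 / (ENNReal.ofReal ps).toReal)
  have hW : W ≠ ∞ := by
    have h1 : volume Bl ≠ 0 := (Metric.measure_ball_pos _ _ one_pos).ne'
    have h2 : volume Bl ≠ ∞ := measure_ball_lt_top.ne
    simp [W, h1, h2]
  set κ := zonalConst d * ENNReal.ofReal ((1 / 2) ^ (d - 2) * (1 / 2) ^ (d - 1))
  have hκ0 : κ ≠ 0 := mul_ne_zero (zonalConst_ne_zero_and_ne_top hd).1
    (ENNReal.ofReal_pos.2 (by positivity)).ne'
  have hκt : κ ≠ ∞ := ENNReal.mul_ne_top (zonalConst_ne_zero_and_ne_top hd).2 (by finiteness)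
  set b := (q⁻¹).toReal
  have hb : 0 ≤ b := ENNReal.toReal_nonneg
  have hlog4 : Real.log 4 ≤ 3 := by
    have := Real.log_le_sub_one_of_pos (show (0 : ℝ) < 4 by norm_num)
    linarith
  have key : (1 : ℝ) ≤ 1 / ps := by
    refine exponent_le_of_forall_mul_rpow_le (K₁ := κ * volume A ^ b)
      (K₂ := C * ((c * 2) ^ (1 / ps) * W)) (R₀ := 3)
      (mul_ne_zero hκ0 (by simp [hA0, hAt]))
      (ENNReal.mul_ne_top hκt (ENNReal.rpow_ne_top_of_nonneg hb hAt))
      (ENNReal.mul_ne_top (by finiteness) (ENNReal.mul_ne_top (ENNReal.rpow_ne_top_of_nonneg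
        (by positivity) (by finiteness)) hW)) ?_
    intro R hR
    have hR0 : 0 < R := by linarith
    -- Chosen so that the logarithm in the lower bound is exactly `R`; the one in the norm is `R +
    -- log 4 ≤ 2 R`, as `R ≥ 3`.
    set a := Real.exp (-R) / 8
    have ha : 0 < a := by positivity
    have ha8 : a ≤ 1 / 8 := by
      have : Real.exp (-R) ≤ 1 := Real.exp_le_one_iff.2 (by linarith)
      simp only [a]
      linarith
    have hlog1 : Real.log (1 / 4 / (2 * a)) = R := by
      rw [show 1 / 4 / (2 * a) = Real.exp R by
        simp only [a]
        rw [Real.exp_neg]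
        field_simp
        norm_num, Real.log_exp]
    have hlog2 : Real.log (1 / 2 / a) ≤ 2 * R := by
      rw [show 1 / 2 / a = 4 * Real.exp R by
        simp only [a]
        rw [Real.exp_neg]
        field_simp
        norm_num, Real.log_mul (by norm_num) (Real.exp_pos R).ne', Real.log_exp]
      linarith
    have hm := measurable_truncatedPower d a
    set f : EuclideanSpace ℝ (Fin d) → ℂ := fun z => (truncatedPower d a ‖z‖ : ℂ)
    have hfm : Measurable f := by fun_prop
    have hfr : IsRadial f := fun x y hxy => by simp only [f, hxy]
    have hen : ∀ z, ‖f z‖ₑ = ENNReal.ofReal (truncatedPower d a ‖z‖) := fun z => by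
      rw [← ofReal_norm, Complex.norm_real, Real.norm_eq_abs,
        abs_of_nonneg (truncatedPower_nonneg ha _)]
    have hsupp : Function.support f ⊆ Bl := by
      intro z hz
      by_contra hzB
      refine hz ?_
      have h1 : 1 ≤ ‖z‖ := by simpa [Bl] using hzB
      have h2 : truncatedPower d a ‖z‖ = 0 :=
        Set.indicator_of_notMem (fun h => by linarith [h.2]) _
      simp [f, h2]
    have hps_norm : eLpNorm f (ENNReal.ofReal ps) volume ≤
        (c * 2) ^ (1 / ps) * ENNReal.ofReal (R ^ (1 / ps)) := by
      rw [eLpNorm_eq_lintegral_rpow_enorm_toReal (ENNReal.ofReal_pos.2 hps).ne'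
        ENNReal.ofReal_ne_top, ENNReal.toReal_ofReal hps.le]
      simp only [hen]
      rw [lintegral_truncatedPower_rpow hd ha (by linarith), ← ENNReal.ofReal_rpow_of_pos hR0,
        ← ENNReal.mul_rpow_of_nonneg _ _ (by positivity), mul_assoc]
      refine ENNReal.rpow_le_rpow (mul_le_mul_right ((ENNReal.ofReal_le_ofReal hlog2).trans
        (le_of_eq ?_)) _) (by positivity)
      rw [ENNReal.ofReal_mul (by norm_num)]
      simp
    have hp_norm : eLpNorm f p volume ≤ (c * 2) ^ (1 / ps) * W * ENNReal.ofReal (R ^ (1 / ps)) := by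
      rw [← eLpNorm_restrict_eq_of_support_subset hsupp]
      refine (eLpNorm_le_eLpNorm_mul_rpow_measure_univ hpps
        hfm.aestronglyMeasurable).trans ?_
      rw [eLpNorm_restrict_eq_of_support_subset hsupp, Measure.restrict_apply_univ]
      refine (mul_le_mul_left hps_norm _).trans (le_of_eq ?_)
      ring
    have hfp : MemLp f p volume := ⟨hfm.aestronglyMeasurable, hp_norm.trans_lt
      (ENNReal.mul_lt_top (ENNReal.mul_lt_top (ENNReal.rpow_ne_top_of_nonneg
        (by positivity) (by finiteness)).lt_top hW.lt_top) ENNReal.ofReal_lt_top)⟩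
    have hlow := mul_measure_rpow_le_eLpNorm hq (G := sphericalMaximal (Set.Icc 1 2) f) hAm hA0
      (κ := κ * ENNReal.ofReal R) fun x hx => by
        have h1 := ofReal_log_le_sphericalMaximal hd ha ha8 (x := x) hx
        rw [hlog1, ← mul_assoc] at h1
        exact h1
    calc κ * volume A ^ b * ENNReal.ofReal (R ^ (1 : ℝ)) = κ * ENNReal.ofReal R * volume A ^ b := by
          rw [Real.rpow_one]
          ring
      _ ≤ C * eLpNorm f p volume := hlow.trans (hC f hfr hfp).2
      _ ≤ C * ((c * 2) ^ (1 / ps) * W * ENNReal.ofReal (R ^ (1 / ps))) :=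
          mul_le_mul_right hp_norm _
      _ = _ := by ring
  rw [one_div, inv_div, le_div_iff₀ (by linarith)] at key
  linarith

/-! ### The triangle in terms of linear inequalities, and the conclusion. -/

theorem mem_segment_vertices_iff {d : ℕ} (hd : 2 ≤ d) (z : ℝ × ℝ) :
    z ∈ segment ℝ (vertexQ1 d 1) (vertexQ2 d 1) ↔
      d * z.1 = (d : ℝ) - 1 ∧ z.1 ≤ d * z.2 ∧ z.2 ≤ z.1 := by
  have hd' : (2 : ℝ) ≤ d := by exact_mod_cast hd
  have hd1 : (0 : ℝ) < (d : ℝ) - 1 := by linarith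
  have hQ1 : vertexQ1 d 1 = (((d : ℝ) - 1) / d, ((d : ℝ) - 1) / d) := by simp [vertexQ1]
  have hQ2 : vertexQ2 d 1 = (((d : ℝ) - 1) / d, ((d : ℝ) - 1) / d ^ 2) := by
    simp only [vertexQ2, sub_add_cancel, Prod.mk.injEq, and_true]
    field_simp
  rw [hQ1, hQ2]
  obtain ⟨u, v⟩ := z
  constructor
  · rintro ⟨a, b, ha, hb, hab, h⟩
    simp only [Prod.smul_mk, Prod.mk_add_mk, smul_eq_mul, Prod.mk.injEq] at h
    obtain ⟨h1, h2⟩ := h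
    have hu : u = ((d : ℝ) - 1) / d := by rw [← h1, ← add_mul, hab, one_mul]
    have hle : ((d : ℝ) - 1) / d ^ 2 ≤ ((d : ℝ) - 1) / d := by
      refine div_le_div_of_nonneg_left hd1.le (by linarith) (by nlinarith)
    have hmul : (d : ℝ) * (((d : ℝ) - 1) / d ^ 2) = ((d : ℝ) - 1) / d := by field_simp
    simp only
    refine ⟨by rw [hu]; field_simp, ?_, ?_⟩
    · have h3 : ((d : ℝ) - 1) / d ^ 2 ≤ v := by
        have h4 : ((d : ℝ) - 1) / d ^ 2 = a * (((d : ℝ) - 1) / d ^ 2) +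
            b * (((d : ℝ) - 1) / d ^ 2) := by rw [← add_mul, hab, one_mul]
        linarith [mul_le_mul_of_nonneg_left hle ha]
      rw [hu, ← hmul]
      exact mul_le_mul_of_nonneg_left h3 (by linarith)
    · linarith [mul_le_mul_of_nonneg_left hle hb]
  · rintro ⟨h1, h2, h3⟩
    simp only at h1 h2 h3
    have hu : u = ((d : ℝ) - 1) / d := by rw [← h1]; field_simp
    have hu0 : 0 < u := by rw [hu]; exact div_pos hd1 (by linarith)
    have hQ : ((d : ℝ) - 1) / d ^ 2 = u / d := by rw [hu]; field_simp
    rw [hQ, ← hu]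
    -- The weights solve `a + b = 1` and `a u + b u / d = v`.
    refine ⟨(d * v - u) / (u * (d - 1)), (d * (u - v)) / (u * (d - 1)),
      div_nonneg (by linarith) (by positivity), div_nonneg (mul_nonneg (by linarith) (by linarith))
        (by positivity), ?_, ?_⟩
    · field_simp
      ring
    · simp only [Prod.smul_mk, Prod.mk_add_mk, smul_eq_mul, Prod.mk.injEq]
      constructor
      · field_simp
        ring
      · field_simp
        ring

theorem mem_triangleDelta_iff {d : ℕ} (hd : 2 ≤ d) (z : ℝ × ℝ) :
    z ∈ triangleDelta d 1 ↔ z.1 ≤ d * z.2 ∧ z.2 ≤ z.1 ∧ d * z.1 ≤ (d : ℝ) - 1 := by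
  have hd' : (2 : ℝ) ≤ d := by exact_mod_cast hd
  have hd1 : (0 : ℝ) < (d : ℝ) - 1 := by linarith
  rw [triangleDelta, convexHull_insert (by simp), convexHull_pair]
  simp only [convexJoin_singleton_left, Set.mem_iUnion, exists_prop]
  constructor
  · rintro ⟨w, hw, a, b, ha, hb, hab, rfl⟩
    obtain ⟨h1, h2, h3⟩ := (mem_segment_vertices_iff hd w).1 hw
    simp only [Prod.fst_add, Prod.snd_add, Prod.smul_fst, Prod.smul_snd, smul_eq_mul, mul_zero,
      zero_add]
    refine ⟨?_, mul_le_mul_of_nonneg_left h3 hb, ?_⟩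
    · calc b * w.1 ≤ b * (d * w.2) := mul_le_mul_of_nonneg_left h2 hb
        _ = _ := by ring
    · calc (d : ℝ) * (b * w.1) = b * (d * w.1) := by ring
        _ = b * (d - 1) := by rw [h1]
        _ ≤ 1 * (d - 1) := mul_le_mul_of_nonneg_right (by linarith) hd1.le
        _ = _ := one_mul _
  · rintro ⟨h1, h2, h3⟩
    have hu : 0 ≤ z.1 := by nlinarith
    rcases hu.eq_or_lt with h0 | h0
    · refine ⟨vertexQ1 d 1, left_mem_segment ℝ _ _, 1, 0, by norm_num, by norm_num, by norm_num, ?_⟩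
      have : z.2 = 0 := le_antisymm (by linarith) (by nlinarith)
      ext <;> simp [← h0, this]
    · set m := ((d : ℝ) - 1) / d
      have hm : 0 < m := div_pos hd1 (by linarith)
      have hdm : d * m = (d : ℝ) - 1 := by simp only [m]; field_simp
      have hzm : z.1 ≤ m := by
        rw [le_div_iff₀ (by linarith)]
        linarith
      -- The point is pushed along its ray from the origin to the side opposite the origin, on which
      -- the first coordinate is `m`.
      refine ⟨(m, z.2 * (m / z.1)), (mem_segment_vertices_iff hd _).2 ⟨hdm, ?_, ?_⟩,
        1 - z.1 / m, z.1 / m, sub_nonneg.2 ((div_le_one hm).2 hzm), by positivity, by ring, ?_⟩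
      · simp only
        rw [← mul_div_assoc, ← mul_div_assoc, le_div_iff₀ h0]
        nlinarith
      · simp only
        rw [← mul_div_assoc, div_le_iff₀ h0]
        nlinarith
      · ext
        · simp
          field_simp
        · simp
          field_simp

theorem theorem1p1 (d : ℕ) (hd : 2 ≤ d) :
    radialTypeSet d (Set.Icc 1 2) =
        triangleDelta d 1 \ segment ℝ (vertexQ1 d 1) (vertexQ2 d 1) ∧
      -- whenever boundedness holds, the spherical means of `L^p_rad` functions are convergent
      -- integrals, simultaneously for all radii, at almost every point
      ∀ p q : ℝ≥0∞, 1 ≤ p → 1 ≤ q → IsRadialStrongType d (Set.Icc 1 2) p q →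
        ∀ f : EuclideanSpace ℝ (Fin d) → ℂ, IsRadial f → MemLp f p volume →
          ∀ᵐ x, ∀ t ∈ Set.Icc (1 : ℝ) 2, Integrable (onSphere f t x) (sphereMeasure d) := by
  have hd' : (2 : ℝ) ≤ d := by exact_mod_cast hd
  have hd0 : (0 : ℝ) < d := by linarith
  constructor
  · ext ⟨u, v⟩
    rw [Set.mem_sdiff, mem_triangleDelta_iff hd, mem_segment_vertices_iff hd]
    constructor
    · rintro ⟨p, q, hp, hq, hz, h⟩
      have hp0 : p ≠ 0 := (zero_lt_one.trans_le hp).ne'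
      have hq0 : q ≠ 0 := (zero_lt_one.trans_le hq).ne'
      obtain ⟨rfl, rfl⟩ := Prod.mk.inj hz
      have h1 := inv_toReal_lt_of_isRadialStrongType hd hq0 h
      rw [lt_div_iff₀ hd0] at h1
      refine ⟨⟨inv_toReal_le_mul_of_isRadialStrongType hd hp0 hq0 h,
        inv_toReal_le_of_isRadialStrongType hd hp0 hq0 h, by linarith⟩, fun h2 => ?_⟩
      linarith [h2.1]
    · rintro ⟨⟨h1, h2, h3⟩, h4⟩
      simp only at h1 h2 h3
      have h5 : d * u < (d : ℝ) - 1 := lt_of_le_of_ne h3 fun h => h4 ⟨h, h1, h2⟩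
      have hu : 0 ≤ u := by nlinarith
      have hu1 : u ≤ 1 := by nlinarith
      rcases hu.eq_or_lt with h0 | h0
      · have hv : v = 0 := le_antisymm (by linarith) (by nlinarith)
        exact ⟨∞, ∞, le_top, le_top, by simp [← h0, hv], isRadialStrongType_top hd⟩
      · have hv : 0 < v := by nlinarith
        -- The ray parameter is `k = q / p = u / v`; its bounds `1 ≤ k ≤ d` are the two sides of the
        -- triangle through the origin.
        have hk : u / v * u⁻¹ = v⁻¹ := by field_simp
        refine ⟨ENNReal.ofReal u⁻¹, ENNReal.ofReal (u / v * u⁻¹), ?_, ?_, ?_,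
          isRadialStrongType_of_lt hd ?_ ?_ ?_⟩
        · rw [ENNReal.one_le_ofReal]
          exact (one_le_inv₀ h0).2 hu1
        · rw [hk, ENNReal.one_le_ofReal]
          exact (one_le_inv₀ hv).2 (h2.trans hu1)
        · rw [hk, ENNReal.ofReal_inv_of_pos h0, ENNReal.ofReal_inv_of_pos hv, inv_inv, inv_inv,
            ENNReal.toReal_ofReal h0.le, ENNReal.toReal_ofReal hv.le]
        · rw [← div_eq_mul_inv, lt_div_iff₀ h0]
          exact h5
        · rwa [one_le_div hv]
        · rwa [div_le_iff₀ hv]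
  · intro p q hp hq h f hf hfp
    have hp0 : p ≠ 0 := (zero_lt_one.trans_le hp).ne'
    have hq0 : q ≠ 0 := (zero_lt_one.trans_le hq).ne'
    have hp' : p = ∞ ∨ (d : ℝ) < ((d : ℝ) - 1) * p.toReal := by
      refine or_iff_not_imp_left.2 fun hpt => ?_
      have h1 := inv_toReal_lt_of_isRadialStrongType hd hq0 h
      have h2 := ENNReal.toReal_pos hp0 hpt
      rw [ENNReal.toReal_inv, lt_div_iff₀ hd0, inv_mul_lt_iff₀ h2] at h1
      linarith
    filter_upwards [ae_ne_zero_euclidean hd] with x hx t ht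
      using integrable_onSphere_of_memLp hd hp' hf hfp hx ht
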